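/- **Setting.** Let $\mathcal S,\mathcal A$ be finite nonempty sets, $\gamma\in[0,1)$, $r_{max}>0$. Each task $\tau$ in a measurable space $\Gamma$ is an MDP $(\mathcal S,\mathcal A,\gamma,\rho_\tau,P_\tau,r_\tau)$ with rewards $r_\tau(s,a,s')\in[0,r_{max}]$, and tasks follow a probability distribution $\mathbb P(\Gamma)$. For a policy $\pi$ let $V^\pi_\tau(s)$ and $Q^\pi_\tau(s,a)$ be the expected values of $\sum_{t\ge 0}\gamma^t r_\tau(s_t,a_t,s_{t+1})$ given $s_0=s$, respectively $s_0=s$, $a_0=a$; let $A^\pi_\tau=Q^\pi_\tau-V^\pi_\tau$, $J_\tau(\pi)=\mathbb E_{s\sim\rho_\tau}[V^\pi_\tau(s)]$ and $\nu^\pi_\tau(s)=(1-\gamma)\sum_{t\ge0}\gamma^t\,\mathbb P(s_t=s\mid s_0\sim\rho_\tau,\pi)$. The tabular softmax policy with parameter $\theta\in\mathbb R^{\mathcal S\times\mathcal A}$ is $\hat\pi_\theta(a|s)=e^{\theta(s,a)}/\sum_{a'}e^{\theta(s,a')}$. For $\lambda>0$ and $i\in\{1,2\}$ the adapted policy is given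 at every state $s$ by $$\mathcal Alg^{(i)}(\hat\pi_\phi,\lambda,\tau)(\cdot|s)=\operatorname*{argmax}_{\hat\pi_\theta(\cdot|s)}\ \sum_{a}\hat\pi_\theta(a|s)\,Q^{\hat\pi_\phi}_\tau(s,a)-\lambda\, d_i^2\big(\hat\pi_\phi(\cdot|s),\hat\pi_\theta(\cdot|s)\big),$$ where $d_1^2(p,q)=D_{KL}(p\|q)$ and $d_2^2(p,q)=D_{KL}(q\|p)$. Put $F_i(\phi)=\mathbb E_{\tau\sim\mathbb P(\Gamma)}[J_\tau(\mathcal Alg^{(i)}(\hat\pi_\phi,\lambda,\tau))]$. **Assumptions.** (1) $A_{max}>0$ and $|A^{\hat\pi_\theta}_\tau(s,a)|\le A_{max}$ for all $\tau,\theta,s,a$. (2) For every task $\tau$ and every bounded set of parameters there is $\epsilon>0$ with $\nu^{\hat\pi_\phi}_\tau(s)\ge\epsilon$ for all $s$ and all $\phi$ in that set. **Algorithm.** Fix $T\ge1$ and $\phi_0$. With $\tau_0,\tau_1,\dots$ i.i.d. from $\mathbb P(\Gamma)$ let $\phi_{t+1}=\phi_t+\alpha\,\nabla_\phi J_{\tau_t}(\mathcal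 Alg^{(i)}(\hat\pi_\phi,\lambda,\tau_t))\big|_{\phi=\phi_t}$. **Constants.** $B_1=\frac{16r_{max}}{\lambda(1-\gamma)^3}+\frac{24}{1-\gamma}+\frac{12}{\lambda}$, $C_1=\frac{6}{1-\gamma}$, $G_1=\frac{4A_{max}}{(1-\gamma)^2}$; $B_2=\frac{16r_{max}}{\lambda(1-\gamma)^3}+\frac{18}{(1-\gamma)^2}$, $C_2=\frac{4}{1-\gamma}$, $G_2=\frac{2A_{max}}{(1-\gamma)^2}$; $K_i=\frac{2(B_i+2C_i^2)r_{max}^2}{(1-\gamma)^4}$, $M_i=\frac{(B_i+2C_i^2)G_ir_{max}}{(1-\gamma)^4}$. **Theorem.** Let $i\in\{1,2\}$, $\lambda\ge 2A_{max}$ and $$\alpha=\min\Big\{\Big(\tfrac{r_{max}B_i}{(1-\gamma)^2}+\tfrac{2\gamma r_{max}C_i^2}{(1-\gamma)^3}\Big)^{-1},\ \tfrac{1}{G_i\sqrt T}\Big\}.$$ Then the argmax defining $\mathcal Alg^{(i)}$ exists and is unique, $\phi\mapsto J_\tau(\mathcal Alg^{(i)}(\hat\pi_\phi,\lambda,\tau))$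 (for every $\tau$) and $F_i$ are well defined and differentiable, the expectations below exist, and $$\frac1T\sum_{t=1}^{T}\mathbb E\big[\|\nabla_\phi F_i(\phi_t)\|^2\big]\ \le\ \frac{K_i}{T}+\frac{M_i}{\sqrt T},$$ where $\mathbb E$ is over the sampled tasks and $\|\cdot\|$ is the Euclidean norm. -/

import Mathlib

open MeasureTheory ProbabilityTheory

noncomputable section

/-- The task-dependent data of a finite Markov decision process with rewards in `[0, rmax]`:
initial distribution, transition probabilities `trans s a s' = P(s' | s, a)` and reward
`reward s a s'`.  The discount factor, common to all tasks, is a separate argument below. -/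
structure TaskMDP (S A : Type*) [Fintype S] (rmax : ℝ) where
  init : S → ℝ
  init_mem : init ∈ stdSimplex ℝ S
  trans : S → A → S → ℝ
  trans_mem : ∀ s a, trans s a ∈ stdSimplex ℝ S
  reward : S → A → S → ℝ
  reward_mem : ∀ s a s', reward s a s' ∈ Set.Icc 0 rmax

/-- Parameters of tabular policies, with the Euclidean norm. -/
abbrev Param (S A : Type*) := EuclideanSpace ℝ (S × A)

/-- The tabular softmax policy `π_θ(a | s)`, proportional to `exp (θ(s, a))`. -/
def softmaxPolicy {S A : Type*} [Fintype A] (θ : Param S A) : S → A → ℝ :=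
  fun s a => Real.exp (θ (s, a)) / ∑ a', Real.exp (θ (s, a'))

section Values

variable {S A : Type*} [Fintype S] [Fintype A] {rmax : ℝ}

/-- The law of `(s_t, a_t)` when `(s_0, a_0)` has law `μ` and the policy `π` is followed from
time `1` on: `s_{t+1}` has law `P(· | s_t, a_t)` and `a_{t+1}` has law `π(· | s_{t+1})`. -/
def stateActionLaw (M : TaskMDP S A rmax) (π : S → A → ℝ) (μ : S → A → ℝ) : ℕ → S → A → ℝ
  | 0 => μ
  | t + 1 => fun s' a' =>
      (∑ s, ∑ a, stateActionLaw M π μ t s a * M.trans s a s') * π s' a'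

/-- The expected discounted return `E[∑_t γ^t r(s_t, a_t, s_{t+1})]` when `(s_0, a_0)` has
law `μ` and the policy `π` is followed afterwards. -/
def expectedReturn (γ : ℝ) (M : TaskMDP S A rmax) (π : S → A → ℝ) (μ : S → A → ℝ) : ℝ :=
  ∑' t : ℕ, γ ^ t *
    ∑ s, ∑ a, ∑ s', stateActionLaw M π μ t s a * M.trans s a s' * M.reward s a s'

/-- The value function `V^π(s)`: start at `s_0 = s` and draw `a_0` from `π(· | s)`. -/
def valueFn [DecidableEq S] (γ : ℝ) (M : TaskMDP S A rmax) (π : S → A → ℝ) (s : S) : ℝ :=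
  expectedReturn γ M π (Pi.single s (π s))

/-- The action-value function `Q^π(s, a)`: start at `s_0 = s`, `a_0 = a`. -/
def qFn [DecidableEq S] [DecidableEq A] (γ : ℝ) (M : TaskMDP S A rmax) (π : S → A → ℝ)
    (s : S) (a : A) : ℝ :=
  expectedReturn γ M π (Pi.single s (Pi.single a 1))

/-- The advantage function `A^π(s, a) = Q^π(s, a) - V^π(s)`. -/
def advantage [DecidableEq S] [DecidableEq A] (γ : ℝ) (M : TaskMDP S A rmax) (π : S → A → ℝ)
    (s : S) (a : A) : ℝ :=
  qFn γ M π s a - valueFn γ M π s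

/-- The accumulated reward `J(π) = E_{s ∼ ρ}[V^π(s)]`. -/
def accReward [DecidableEq S] (γ : ℝ) (M : TaskMDP S A rmax) (π : S → A → ℝ) : ℝ :=
  ∑ s, M.init s * valueFn γ M π s

/-- The discounted state visitation distribution
`ν^π(s) = (1 - γ) ∑_t γ^t P(s_t = s | π)`, with `s_0` drawn from the initial distribution. -/
def visitation (γ : ℝ) (M : TaskMDP S A rmax) (π : S → A → ℝ) (s : S) : ℝ :=
  (1 - γ) * ∑' t : ℕ, γ ^ t *
    ∑ a, stateActionLaw M π (fun s₀ a₀ => M.init s₀ * π s₀ a₀) t s a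

end Values

/-- The Kullback-Leibler divergence `KL(p ‖ q)` on a finite set.  It is only applied to
strictly positive `p` and `q`. -/
def klFin {A : Type*} [Fintype A] (p q : A → ℝ) : ℝ :=
  ∑ a, p a * Real.log (p a / q a)

/-- The index `i = 1, 2` of the within-task algorithm. -/
inductive AlgIndex
  | one
  | two

/-- The squared distances `d_1²(p, q) = KL(p ‖ q)` and `d_2²(p, q) = KL(q ‖ p)`. -/
def AlgIndex.distSq {A : Type*} [Fintype A] : AlgIndex → (A → ℝ) → (A → ℝ) → ℝ
  | .one, p, q => klFin p q
  | .two, p, q => klFin q p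

section WithinTask

variable {S A : Type*} [Fintype S] [Fintype A] [DecidableEq S] [DecidableEq A] {rmax : ℝ}

/-- The within-task objective at the state `s`:
`∑_a q(a) Q^{π_φ}(s, a) - lam * d_i²(π_φ(· | s), q)`. -/
def adaptObjective (i : AlgIndex) (γ lam : ℝ) (M : TaskMDP S A rmax) (φ : Param S A) (s : S)
    (q : A → ℝ) : ℝ :=
  ∑ a, q a * qFn γ M (softmaxPolicy φ) s a - lam * i.distSq (softmaxPolicy φ s) q

/-- `q` maximizes the within-task objective at `s` among the action distributions
`π_θ(· | s)` of the softmax policies. -/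
def IsAdapted (i : AlgIndex) (γ lam : ℝ) (M : TaskMDP S A rmax) (φ : Param S A) (s : S)
    (q : A → ℝ) : Prop :=
  q ∈ Set.range (fun θ : Param S A => softmaxPolicy θ s) ∧
    IsMaxOn (adaptObjective i γ lam M φ s) (Set.range fun θ : Param S A => softmaxPolicy θ s) q

/-- The adapted policy `Alg^(i)(π_φ, lam, τ)`: at every state the argmax of the within-task
objective. -/
def alg (i : AlgIndex) (γ lam : ℝ) (M : TaskMDP S A rmax) (φ : Param S A) : S → A → ℝ :=
  fun s => Classical.epsilon (IsAdapted i γ lam M φ s)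

/-- The accumulated reward `J_τ(Alg^(i)(π_φ, lam, τ))` after adaptation, as a function of `φ`. -/
def adaptedReward (i : AlgIndex) (γ lam : ℝ) (M : TaskMDP S A rmax) (φ : Param S A) : ℝ :=
  accReward γ M (alg i γ lam M φ)

/-- The meta-objective `E_{τ ∼ P}[J_τ(Alg^(i)(π_φ, lam, τ))]`. -/
def metaObjective {Γ : Type*} [MeasurableSpace Γ] (i : AlgIndex) (γ lam : ℝ)
    (M : Γ → TaskMDP S A rmax) (P : Measure Γ) (φ : Param S A) : ℝ :=
  ∫ τ, adaptedReward i γ lam (M τ) φ ∂P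

/-- The meta-training iterates
`φ_{t+1} = φ_t + α ∇_φ J_{τ_t}(Alg^(i)(π_{φ_t}, lam, τ_t))`
along the sequence `τ` of sampled tasks. -/
def metaIterate {Γ : Type*} (i : AlgIndex) (γ lam α : ℝ) (M : Γ → TaskMDP S A rmax)
    (φ₀ : Param S A) (τ : ℕ → Γ) : ℕ → Param S A
  | 0 => φ₀
  | t + 1 => metaIterate i γ lam α M φ₀ τ t +
      α • gradient (adaptedReward i γ lam (M (τ t))) (metaIterate i γ lam α M φ₀ τ t)

end WithinTask

/-- The constants `B_i`. -/
def AlgIndex.constB (i : AlgIndex) (γ rmax lam : ℝ) : ℝ :=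
  match i with
  | .one => 16 * rmax / (lam * (1 - γ) ^ 3) + 24 / (1 - γ) + 12 / lam
  | .two => 16 * rmax / (lam * (1 - γ) ^ 3) + 18 / (1 - γ) ^ 2

/-- The constants `C_i`. -/
def AlgIndex.constC (i : AlgIndex) (γ : ℝ) : ℝ :=
  match i with
  | .one => 6 / (1 - γ)
  | .two => 4 / (1 - γ)

/-- The constants `G_i`. -/
def AlgIndex.constG (i : AlgIndex) (γ Amax : ℝ) : ℝ :=
  match i with
  | .one => 4 * Amax / (1 - γ) ^ 2
  | .two => 2 * Amax / (1 - γ) ^ 2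

/-- `K_i = 2 (B_i + 2 C_i²) r_max² / (1 - γ)⁴`. -/
def AlgIndex.constK (i : AlgIndex) (γ rmax lam : ℝ) : ℝ :=
  2 * (i.constB γ rmax lam + 2 * i.constC γ ^ 2) * rmax ^ 2 / (1 - γ) ^ 4

/-- `M_i = (B_i + 2 C_i²) G_i r_max / (1 - γ)⁴`. -/
def AlgIndex.constM (i : AlgIndex) (γ rmax Amax lam : ℝ) : ℝ :=
  (i.constB γ rmax lam + 2 * i.constC γ ^ 2) * i.constG γ Amax * rmax / (1 - γ) ^ 4

/-- The step size
`min {(r_max B_i / (1-γ)² + 2 γ r_max C_i² / (1-γ)³)⁻¹, 1 / (G_i √T)}`. -/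
def AlgIndex.stepSize (i : AlgIndex) (γ rmax Amax lam : ℝ) (T : ℕ) : ℝ :=
  min (rmax * i.constB γ rmax lam / (1 - γ) ^ 2
        + 2 * γ * rmax * i.constC γ ^ 2 / (1 - γ) ^ 3)⁻¹
    (1 / (i.constG γ Amax * √(T : ℝ)))

end

/-!
The adapted policy has a closed form.  With `p = π_φ(· | s)` and `z = Q^{π_φ}(s, ·) / lam`, the
objective for `KL(q ‖ p)` is maximized by the exponential tilt `q ∝ p exp z`, and the one for
`KL(p ‖ q)` by the rational tilt `q = p / (m - z)`, where `m > max z` is the number that makes `q`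
a probability vector.  Both claims are the strict inequality `log x < x - 1`, summed against a
suitable weight (`objective_lt_objective_tilt`).

Smoothness of the adapted reward in `φ` and joint continuity in the task and `φ` then come from two
facts: values solve the Bellman equation, so `V^π = (1 - γ P_π)⁻¹ r_π` is smooth in all its data
(`contDiffAt_bellmanValue`), and `m` is smooth in `(p, z)` by the implicit function theorem
(`contDiffAt_tiltShift_prod`).

The quantitative part is carried out along lines `t ↦ φ + t u` with `‖u‖ = 1`.  If
`∑ |π'| ≤ c₁` and `∑ |π''| ≤ c₂` at every state, then differentiating the Bellman equation twice
and applying the maximum principle bounds `V'` by `c₁ Amax / (1 - γ)` (only advantages enter, since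
`∑ π' = 0`) and `V''` by `(c₂ R + 2 γ c₁² R / (1 - γ)) / (1 - γ)` with `R = rmax / (1 - γ)`.  This
is used first for the softmax policies, which controls `Q'` and `Q''`, and then for the adapted
policies, whose `c₁` and `c₂` follow from the closed form (`sum_abs_deriv_exp_le`,
`sum_abs_deriv_tilt_one_le`).  The condition `lam ≥ 2 Amax` enters as `|z - ∑ p z| ≤ 1 / 2`: it
keeps the weights `1 / (m - z)` below `2`.  The outcome is that every adapted reward has gradient
of norm at most `G_i` and satisfies a quadratic lower bound with constant `AlgIndex.smoothness`.

These properties pass to the meta-objective by integration.  The iterate `φ_t` is a function of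
`τ_0, …, τ_{t-1}`, hence independent of `τ_t`, so the sampled gradient is unbiased in mean
(`integral_inner_gradient_eq`), and telescoping the ascent inequality gives
`∑ E‖∇F(φ_t)‖² ≤ 2 R / α + T L α G² / 2` (`sum_integral_norm_gradient_sq_le`).  Inserting the step
size yields the rate (`AlgIndex.rate_le`).
-/

/-! ### The Bellman equation and the expected return -/

section Bellman

variable {S A : Type*} [Fintype S] [Fintype A]

theorem abs_sum_le_of_mem_stdSimplex {ι : Type*} [Fintype ι] {p x : ι → ℝ} {c : ℝ}
    (hp : p ∈ stdSimplex ℝ ι) (hx : ∀ i, |x i| ≤ c) : |∑ i, p i * x i| ≤ c := by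
  calc |∑ i, p i * x i| ≤ ∑ i, |p i * x i| := Finset.abs_sum_le_sum_abs _ _
    _ ≤ ∑ i, p i * c := Finset.sum_le_sum fun i _ => by
        rw [abs_mul, abs_of_nonneg (hp.1 i)]
        exact mul_le_mul_of_nonneg_left (hx i) (hp.1 i)
    _ = c := by rw [← Finset.sum_mul, hp.2, one_mul]

/-- The maximum principle for the Bellman equation: if `|x| ≤ κ + γ |y|` where `y` averages `x`,
then `|x| ≤ κ / (1 - γ)`. -/
theorem abs_le_div_of_abs_le_add {γ κ : ℝ} (hγ₀ : 0 ≤ γ) (hγ₁ : γ < 1) {x y : S → ℝ}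
    (hxy : ∀ s c, (∀ s', |x s'| ≤ c) → |y s| ≤ c)
    (h : ∀ s, |x s| ≤ κ + γ * |y s|) (s : S) : |x s| ≤ κ / (1 - γ) := by
  obtain ⟨s₀, -, hs₀⟩ := Finset.exists_max_image Finset.univ (fun s => |x s|) ⟨s, Finset.mem_univ s⟩
  have h1 := hxy s₀ (|x s₀|) fun s' => hs₀ s' (Finset.mem_univ _)
  have h2 := h s₀
  have h3 := mul_le_mul_of_nonneg_left h1 hγ₀
  rw [le_div_iff₀ (by linarith)]
  have h4 := hs₀ s (Finset.mem_univ _)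
  nlinarith

/-- The evolution of signed state-action measures does not increase the total variation. -/
theorem sum_abs_stateActionLaw_le {rmax : ℝ} (M : TaskMDP S A rmax) {π : S → A → ℝ}
    (hπ : ∀ s, π s ∈ stdSimplex ℝ A) (μ : S → A → ℝ) (t : ℕ) :
    ∑ s, ∑ a, |stateActionLaw M π μ t s a| ≤ ∑ s, ∑ a, |μ s a| := by
  induction t with
  | zero => exact le_rfl
  | succ t ih =>
    refine le_trans ?_ ih
    have h1 : ∀ s' a', |stateActionLaw M π μ (t + 1) s' a'| ≤
        (∑ s, ∑ a, |stateActionLaw M π μ t s a| * M.trans s a s') * π s' a' := by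
      intro s' a'
      rw [stateActionLaw, abs_mul, abs_of_nonneg ((hπ s').1 a')]
      refine mul_le_mul_of_nonneg_right ?_ ((hπ s').1 a')
      refine (Finset.abs_sum_le_sum_abs _ _).trans (Finset.sum_le_sum fun s _ => ?_)
      refine (Finset.abs_sum_le_sum_abs _ _).trans (Finset.sum_le_sum fun a _ => ?_)
      rw [abs_mul, abs_of_nonneg ((M.trans_mem s a).1 s')]
    calc ∑ s', ∑ a', |stateActionLaw M π μ (t + 1) s' a'|
        ≤ ∑ s', ∑ a', (∑ s, ∑ a, |stateActionLaw M π μ t s a| * M.trans s a s') * π s' a' :=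
          Finset.sum_le_sum fun s' _ => Finset.sum_le_sum fun a' _ => h1 s' a'
      _ = ∑ s', ∑ s, ∑ a, |stateActionLaw M π μ t s a| * M.trans s a s' := by
          refine Finset.sum_congr rfl fun s' _ => ?_
          rw [← Finset.mul_sum, (hπ s').2, mul_one]
      _ = ∑ s, ∑ a, |stateActionLaw M π μ t s a| := by
          rw [Finset.sum_comm]
          refine Finset.sum_congr rfl fun s _ => ?_
          rw [Finset.sum_comm]
          refine Finset.sum_congr rfl fun a _ => ?_
          rw [← Finset.mul_sum, (M.trans_mem s a).2, mul_one]

theorem abs_sum_sum_mul_le {ν q : S → A → ℝ} {c : ℝ} (hq : ∀ s a, |q s a| ≤ c) :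
    |∑ s, ∑ a, ν s a * q s a| ≤ (∑ s, ∑ a, |ν s a|) * c := by
  rw [Finset.sum_mul]
  refine (Finset.abs_sum_le_sum_abs _ _).trans (Finset.sum_le_sum fun s _ => ?_)
  rw [Finset.sum_mul]
  refine (Finset.abs_sum_le_sum_abs _ _).trans (Finset.sum_le_sum fun a _ => ?_)
  rw [abs_mul]
  exact mul_le_mul_of_nonneg_left (hq s a) (abs_nonneg _)

variable [DecidableEq S]

/-- The transition operator `x ↦ (s ↦ E[x(s_1) | s_0 = s])` of the policy `π` as a continuous
linear map. -/
noncomputable def transitionOp (T : S → A → S → ℝ) (π : S → A → ℝ) : (S → ℝ) →L[ℝ] (S → ℝ) :=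
  ∑ s, ∑ s', (∑ a, π s a * T s a s') •
    (ContinuousLinearMap.proj (R := ℝ) (φ := fun _ : S => ℝ) s').smulRight (Pi.single s (1 : ℝ))

theorem transitionOp_apply (T : S → A → S → ℝ) (π : S → A → ℝ) (x : S → ℝ) (s : S) :
    transitionOp T π x s = ∑ a, π s a * ∑ s', T s a s' * x s' := by
  have : transitionOp T π x s = ∑ s', (∑ a, π s a * T s a s') * x s' := by
    simp only [transitionOp, sum_apply, smul_apply,
      ContinuousLinearMap.smulRight_apply, ContinuousLinearMap.proj_apply, Finset.sum_apply,
      Pi.smul_apply, smul_eq_mul, Pi.single_apply]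
    simp
  rw [this]
  simp_rw [Finset.sum_mul, Finset.mul_sum]
  rw [Finset.sum_comm]
  simp only [mul_assoc]

/-- The solution `V` of the Bellman equation `V = r_π + γ P_π V` of the policy `π`.  The inverse is
the genuine one for a stochastic policy and kernel (`isUnit_one_sub_transitionOp`), and the value
`0` of `Ring.inverse` at noninvertible operators plays no role. -/
noncomputable def bellmanValue (γ : ℝ) (T R : S → A → S → ℝ) (π : S → A → ℝ) : S → ℝ :=
  Ring.inverse (1 - γ • transitionOp T π) fun s => ∑ a, π s a * ∑ s', T s a s' * R s a s'

/-- The action values `Q(s, a) = E[r + γ V(s')]` attached to `bellmanValue`. -/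
noncomputable def bellmanQ (γ : ℝ) (T R : S → A → S → ℝ) (π : S → A → ℝ) (s : S) (a : A) : ℝ :=
  ∑ s', T s a s' * (R s a s' + γ * bellmanValue γ T R π s')

theorem isUnit_one_sub_transitionOp {γ : ℝ} (hγ₀ : 0 ≤ γ) (hγ₁ : γ < 1) {T : S → A → S → ℝ}
    (hT : ∀ s a, T s a ∈ stdSimplex ℝ S) {π : S → A → ℝ} (hπ : ∀ s, π s ∈ stdSimplex ℝ A) :
    IsUnit (1 - γ • transitionOp T π) := by
  apply isUnit_one_sub_of_norm_lt_one
  refine lt_of_le_of_lt ?_ hγ₁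
  rw [norm_smul, Real.norm_of_nonneg hγ₀]
  refine mul_le_of_le_one_right hγ₀ (ContinuousLinearMap.opNorm_le_bound _ zero_le_one fun x => ?_)
  rw [one_mul, pi_norm_le_iff_of_nonneg (norm_nonneg _)]
  intro s
  rw [transitionOp_apply, Real.norm_eq_abs]
  exact abs_sum_le_of_mem_stdSimplex (hπ s) fun a => abs_sum_le_of_mem_stdSimplex (hT s a)
    fun s' => norm_le_pi_norm x s'

theorem bellmanValue_eq {γ : ℝ} (hγ₀ : 0 ≤ γ) (hγ₁ : γ < 1) {T : S → A → S → ℝ}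
    (hT : ∀ s a, T s a ∈ stdSimplex ℝ S) (R : S → A → S → ℝ) {π : S → A → ℝ}
    (hπ : ∀ s, π s ∈ stdSimplex ℝ A) (s : S) :
    bellmanValue γ T R π s = ∑ a, π s a * bellmanQ γ T R π s a := by
  have h := Ring.mul_inverse_cancel _ (isUnit_one_sub_transitionOp hγ₀ hγ₁ hT hπ)
  have h2 := congrFun (congrArg (fun L : (S → ℝ) →L[ℝ] (S → ℝ) =>
    L fun s => ∑ a, π s a * ∑ s', T s a s' * R s a s') h) s
  change (1 - γ • transitionOp T π) (bellmanValue γ T R π) s = _ at h2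
  simp only [sub_apply, one_apply_eq_self, Pi.sub_apply,
    smul_apply, Pi.smul_apply, smul_eq_mul, transitionOp_apply] at h2
  rw [sub_eq_iff_eq_add] at h2
  rw [h2, Finset.mul_sum, ← Finset.sum_add_distrib]
  refine Finset.sum_congr rfl fun a _ => ?_
  simp only [bellmanQ, mul_add, Finset.sum_add_distrib, Finset.mul_sum]
  congr 1
  exact Finset.sum_congr rfl fun s' _ => by ring

/-- The expected return is the pairing of the initial law with the action values: the partial sums
of the series telescope along the Bellman equation, with remainder `γ ^ n ⟨law_n, Q⟩ → 0`. -/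
theorem expectedReturn_eq {γ rmax : ℝ} (hγ₀ : 0 ≤ γ) (hγ₁ : γ < 1) (M : TaskMDP S A rmax)
    {π : S → A → ℝ} (hπ : ∀ s, π s ∈ stdSimplex ℝ A) (μ : S → A → ℝ) :
    expectedReturn γ M π μ = ∑ s, ∑ a, μ s a * bellmanQ γ M.trans M.reward π s a := by
  set q := bellmanQ γ M.trans M.reward π with hq
  set v := bellmanValue γ M.trans M.reward π with hv
  set law := stateActionLaw M π μ with hlaw
  have hv_eq : ∀ s, v s = ∑ a, π s a * q s a :=
    bellmanValue_eq hγ₀ hγ₁ M.trans_mem M.reward hπ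
  have hrew : ∀ t, ∑ s, ∑ a, ∑ s', law t s a * M.trans s a s' * M.reward s a s' =
      ∑ s, ∑ a, law t s a * ∑ s', M.trans s a s' * M.reward s a s' := by
    intro t
    simp only [Finset.mul_sum, mul_assoc]
  have hstep : ∀ t, ∑ s, ∑ a, law t s a * q s a =
      (∑ s, ∑ a, ∑ s', law t s a * M.trans s a s' * M.reward s a s') +
        γ * ∑ s, ∑ a, law (t + 1) s a * q s a := by
    intro t
    have h1 : ∑ s, ∑ a, law (t + 1) s a * q s a =
        ∑ s, ∑ a, ∑ s', law t s a * M.trans s a s' * v s' := by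
      calc ∑ s', ∑ a', law (t + 1) s' a' * q s' a'
          = ∑ s', (∑ s, ∑ a, law t s a * M.trans s a s') * v s' := by
            refine Finset.sum_congr rfl fun s' _ => ?_
            rw [hv_eq, Finset.mul_sum]
            refine Finset.sum_congr rfl fun a' _ => ?_
            rw [hlaw, stateActionLaw, mul_assoc]
        _ = _ := by
            simp only [Finset.sum_mul]
            rw [Finset.sum_comm]
            refine Finset.sum_congr rfl fun s _ => ?_
            rw [Finset.sum_comm]
    rw [h1]
    simp only [Finset.mul_sum, ← Finset.sum_add_distrib]
    refine Finset.sum_congr rfl fun s _ => Finset.sum_congr rfl fun a _ => ?_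
    rw [hq, bellmanQ, Finset.mul_sum]
    exact Finset.sum_congr rfl fun s' _ => by ring
  set mass := ∑ s, ∑ a, |μ s a| with hmass
  have hmass_nonneg : 0 ≤ mass := Finset.sum_nonneg fun s _ => Finset.sum_nonneg fun a _ =>
    abs_nonneg _
  have hpair : ∀ {f : S → A → ℝ} {c : ℝ}, 0 ≤ c → (∀ s a, |f s a| ≤ c) → ∀ t,
      |∑ s, ∑ a, law t s a * f s a| ≤ mass * c := fun hc hf t =>
    (abs_sum_sum_mul_le hf).trans
      (mul_le_mul_of_nonneg_right (sum_abs_stateActionLaw_le M hπ μ t) hc)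
  have hbdd : ∀ f : S → A → ℝ, ∃ c, 0 ≤ c ∧ ∀ s a, |f s a| ≤ c := fun f =>
    ⟨∑ s, ∑ a, |f s a|, Finset.sum_nonneg fun s _ => Finset.sum_nonneg fun a _ => abs_nonneg _,
      fun s a => (Finset.single_le_sum (f := fun a => |f s a|) (fun a _ => abs_nonneg _)
        (Finset.mem_univ a)).trans
        (Finset.single_le_sum (f := fun s => ∑ a, |f s a|)
          (fun s _ => Finset.sum_nonneg fun a _ => abs_nonneg _) (Finset.mem_univ s))⟩
  obtain ⟨c, hc, hqc⟩ := hbdd q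
  obtain ⟨c', hc', hrc⟩ := hbdd fun s a => ∑ s', M.trans s a s' * M.reward s a s'
  have hsummable : Summable fun t : ℕ => γ ^ t *
      ∑ s, ∑ a, ∑ s', law t s a * M.trans s a s' * M.reward s a s' := by
    refine Summable.of_norm_bounded (g := fun t : ℕ => γ ^ t * (mass * c'))
      ((summable_geometric_of_lt_one hγ₀ hγ₁).mul_right _) fun t => ?_
    rw [norm_mul, norm_pow, Real.norm_of_nonneg hγ₀, hrew, Real.norm_eq_abs]
    exact mul_le_mul_of_nonneg_left (hpair hc' hrc t) (pow_nonneg hγ₀ t)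
  have hpartial : ∀ n : ℕ, ∑ t ∈ Finset.range n, γ ^ t *
      ∑ s, ∑ a, ∑ s', law t s a * M.trans s a s' * M.reward s a s' =
      ∑ s, ∑ a, μ s a * q s a - γ ^ n * ∑ s, ∑ a, law n s a * q s a := by
    intro n
    induction n with
    | zero => simp [hlaw, stateActionLaw]
    | succ n ih =>
      rw [Finset.sum_range_succ, ih, hstep n]
      ring
  refine tendsto_nhds_unique hsummable.hasSum.tendsto_sum_nat ?_
  simp only [hpartial]
  have hzero : Filter.Tendsto (fun n : ℕ => γ ^ n * ∑ s, ∑ a, law n s a * q s a)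
      Filter.atTop (nhds 0) := by
    refine squeeze_zero_norm (a := fun n : ℕ => γ ^ n * (mass * c)) (fun n => ?_) ?_
    · rw [norm_mul, norm_pow, Real.norm_of_nonneg hγ₀, Real.norm_eq_abs]
      exact mul_le_mul_of_nonneg_left (hpair hc hqc n) (pow_nonneg hγ₀ n)
    · simpa using (tendsto_pow_atTop_nhds_zero_of_lt_one hγ₀ hγ₁).mul_const (mass * c)
  simpa using tendsto_const_nhds.sub hzero

variable {γ rmax : ℝ}

theorem valueFn_eq_bellmanValue (hγ₀ : 0 ≤ γ) (hγ₁ : γ < 1) (M : TaskMDP S A rmax)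
    {π : S → A → ℝ} (hπ : ∀ s, π s ∈ stdSimplex ℝ A) (s : S) :
    valueFn γ M π s = bellmanValue γ M.trans M.reward π s := by
  rw [valueFn, expectedReturn_eq hγ₀ hγ₁ M hπ, Finset.sum_eq_single s,
    bellmanValue_eq hγ₀ hγ₁ M.trans_mem M.reward hπ]
  · simp
  · intro b _ hb
    simp [hb]
  · simp

variable [DecidableEq A]

theorem qFn_eq_bellmanQ (hγ₀ : 0 ≤ γ) (hγ₁ : γ < 1) (M : TaskMDP S A rmax) {π : S → A → ℝ}
    (hπ : ∀ s, π s ∈ stdSimplex ℝ A) (s : S) (a : A) :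
    qFn γ M π s a = bellmanQ γ M.trans M.reward π s a := by
  rw [qFn, expectedReturn_eq hγ₀ hγ₁ M hπ, Finset.sum_eq_single s, Finset.sum_eq_single a]
  · simp
  · intro b _ hb
    simp [hb]
  · simp
  · intro b _ hb
    simp [hb]
  · simp

end Bellman

/-! ### Smoothness of the value in its data -/

section BellmanSmooth

variable {S A E : Type*} [Fintype S] [Fintype A] [DecidableEq S] [NormedAddCommGroup E]
  [NormedSpace ℝ E] {n : WithTop ℕ∞} {γ : ℝ} {T R : E → S → A → S → ℝ} {π : E → S → A → ℝ} {x : E}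

theorem contDiffAt_bellmanValue (hγ₀ : 0 ≤ γ) (hγ₁ : γ < 1)
    (hT : ∀ s a, T x s a ∈ stdSimplex ℝ S) (hπ : ∀ s, π x s ∈ stdSimplex ℝ A)
    (dT : ∀ s a s', ContDiffAt ℝ n (fun y => T y s a s') x)
    (dR : ∀ s a s', ContDiffAt ℝ n (fun y => R y s a s') x)
    (dπ : ∀ s a, ContDiffAt ℝ n (fun y => π y s a) x) (s : S) :
    ContDiffAt ℝ n (fun y => bellmanValue γ (T y) (R y) (π y) s) x := by
  have hop : ContDiffAt ℝ n (fun y => 1 - γ • transitionOp (T y) (π y)) x := by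
    unfold transitionOp
    fun_prop
  have hrew : ContDiffAt ℝ n
      (fun y => (fun s => ∑ a, π y s a * ∑ s', T y s a s' * R y s a s' : S → ℝ)) x := by
    rw [contDiffAt_pi]
    intro s
    fun_prop
  obtain ⟨U, hU⟩ := isUnit_one_sub_transitionOp hγ₀ hγ₁ hT hπ
  have hinv := contDiffAt_ringInverse (n := n) ℝ U
  rw [hU] at hinv
  have h := (hinv.comp x hop).clm_apply hrew
  exact contDiffAt_pi.1 h s

theorem contDiffAt_bellmanQ (hγ₀ : 0 ≤ γ) (hγ₁ : γ < 1)
    (hT : ∀ s a, T x s a ∈ stdSimplex ℝ S) (hπ : ∀ s, π x s ∈ stdSimplex ℝ A)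
    (dT : ∀ s a s', ContDiffAt ℝ n (fun y => T y s a s') x)
    (dR : ∀ s a s', ContDiffAt ℝ n (fun y => R y s a s') x)
    (dπ : ∀ s a, ContDiffAt ℝ n (fun y => π y s a) x) (s : S) (a : A) :
    ContDiffAt ℝ n (fun y => bellmanQ γ (T y) (R y) (π y) s a) x := by
  have h := contDiffAt_bellmanValue hγ₀ hγ₁ hT hπ dT dR dπ
  unfold bellmanQ
  fun_prop

end BellmanSmooth

/-! ### The within-task maximizer -/

section Response

variable {A : Type*} [Fintype A]

/-- `m` normalizes the weights `p a / (m - z a)` to a probability vector, on the branch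
`m > max z` where all weights are positive. -/
def IsTiltShift (p z : A → ℝ) (m : ℝ) : Prop :=
  (∀ a, z a < m) ∧ ∑ a, p a / (m - z a) = 1

/-- The normalizing shift of `IsTiltShift`; it exists and is unique for a strictly positive
probability vector `p`. -/
noncomputable def tiltShift (p z : A → ℝ) : ℝ :=
  Classical.epsilon (IsTiltShift p z)

/-- The maximizer of `q ↦ ∑ a, q a * z a - d_i²(p, q)` over the open simplex: the rational tilt
`p a / (m - z a)` for `KL(p ‖ q)` and the exponential tilt for `KL(q ‖ p)`. -/
noncomputable def tilt (i : AlgIndex) (p z : A → ℝ) (a : A) : ℝ :=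
  match i with
  | .one => p a / (tiltShift p z - z a)
  | .two => p a * Real.exp (z a) / ∑ b, p b * Real.exp (z b)

theorem IsTiltShift.unique [Nonempty A] {p z : A → ℝ} (hp : ∀ a, 0 < p a) {m m' : ℝ}
    (h : IsTiltShift p z m) (h' : IsTiltShift p z m') : m = m' := by
  have key : ∀ {k l : ℝ}, IsTiltShift p z k → IsTiltShift p z l → ¬ k < l := by
    intro k l hk hl hkl
    have : ∑ a, p a / (l - z a) < ∑ a, p a / (k - z a) :=
      Finset.sum_lt_sum_of_nonempty Finset.univ_nonempty fun a _ =>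
        div_lt_div_of_pos_left (hp a) (by linarith [hk.1 a]) (by linarith)
    rw [hk.2, hl.2] at this
    exact lt_irrefl _ this
  exact le_antisymm (not_lt.1 (key h' h)) (not_lt.1 (key h h'))

theorem exists_isTiltShift [Nonempty A] {p : A → ℝ} (hp : ∀ a, 0 < p a) (hp1 : ∑ a, p a = 1)
    (z : A → ℝ) : ∃ m, IsTiltShift p z m := by
  obtain ⟨a₀, -, ha₀⟩ := Finset.exists_max_image Finset.univ z Finset.univ_nonempty
  have hple : p a₀ ≤ 1 := hp1 ▸ Finset.single_le_sum (fun a _ => (hp a).le) (Finset.mem_univ a₀)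
  have hlt : ∀ m ∈ Set.Icc (z a₀ + p a₀) (z a₀ + 1), ∀ a, z a < m := fun m hm a => by
    linarith [ha₀ a (Finset.mem_univ a), hm.1, hp a₀]
  -- The sum of the weights crosses `1` between `max z + p a₀` and `max z + 1`.
  have hcont : ContinuousOn (fun m => ∑ a, p a / (m - z a))
      (Set.Icc (z a₀ + p a₀) (z a₀ + 1)) := by
    refine continuousOn_finsetSum _ fun a _ => ?_
    refine ContinuousOn.div (by fun_prop) (by fun_prop) fun m hm => ?_
    exact (sub_pos.2 (hlt m hm a)).ne'
  have hend : z a₀ + p a₀ ≤ z a₀ + 1 := by linarith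
  have hlow : ∑ a, p a / (z a₀ + 1 - z a) ≤ 1 := by
    rw [← hp1]
    refine Finset.sum_le_sum fun a _ => div_le_self (hp a).le ?_
    linarith [ha₀ a (Finset.mem_univ a)]
  have hhigh : 1 ≤ ∑ a, p a / (z a₀ + p a₀ - z a) := by
    have h1 : p a₀ / (z a₀ + p a₀ - z a₀) = 1 := by
      rw [add_sub_cancel_left, div_self (hp a₀).ne']
    rw [← h1]
    refine Finset.single_le_sum (f := fun a => p a / (z a₀ + p a₀ - z a))
      (fun a _ => div_nonneg (hp a).le ?_) (Finset.mem_univ a₀)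
    linarith [ha₀ a (Finset.mem_univ a), hp a₀]
  obtain ⟨m, hm, hm1⟩ := intermediate_value_Icc' hend hcont ⟨hlow, hhigh⟩
  exact ⟨m, hlt m hm, hm1⟩

theorem isTiltShift_tiltShift [Nonempty A] {p : A → ℝ} (hp : ∀ a, 0 < p a) (hp1 : ∑ a, p a = 1)
    (z : A → ℝ) : IsTiltShift p z (tiltShift p z) :=
  Classical.epsilon_spec (exists_isTiltShift hp hp1 z)

theorem tilt_pos [Nonempty A] (i : AlgIndex) {p : A → ℝ} (hp : ∀ a, 0 < p a)
    (hp1 : ∑ a, p a = 1) (z : A → ℝ) (a : A) : 0 < tilt i p z a := by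
  cases i with
  | one => exact div_pos (hp a) (sub_pos.2 ((isTiltShift_tiltShift hp hp1 z).1 a))
  | two =>
    exact div_pos (mul_pos (hp a) (Real.exp_pos _))
      (Finset.sum_pos (fun b _ => mul_pos (hp b) (Real.exp_pos _)) Finset.univ_nonempty)

theorem sum_tilt [Nonempty A] (i : AlgIndex) {p : A → ℝ} (hp : ∀ a, 0 < p a)
    (hp1 : ∑ a, p a = 1) (z : A → ℝ) : ∑ a, tilt i p z a = 1 := by
  cases i with
  | one => exact (isTiltShift_tiltShift hp hp1 z).2
  | two =>
    simp only [tilt]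
    rw [← Finset.sum_div, div_self]
    exact (Finset.sum_pos (fun b _ => mul_pos (hp b) (Real.exp_pos _)) Finset.univ_nonempty).ne'

theorem tilt_mem_stdSimplex [Nonempty A] (i : AlgIndex) {p : A → ℝ} (hp : ∀ a, 0 < p a)
    (hp1 : ∑ a, p a = 1) (z : A → ℝ) : tilt i p z ∈ stdSimplex ℝ A :=
  ⟨fun a => (tilt_pos i hp hp1 z a).le, sum_tilt i hp hp1 z⟩

/-- A weighted form of `log x < x - 1`, strict because `q ≠ t`. -/
theorem sum_mul_log_div_lt {w q t : A → ℝ} (hw : ∀ a, 0 < w a) (hq : ∀ a, 0 < q a)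
    (ht : ∀ a, 0 < t a) (hqt : q ≠ t) :
    ∑ a, w a * Real.log (q a / t a) < ∑ a, w a * (q a / t a - 1) := by
  obtain ⟨a, ha⟩ := Function.ne_iff.1 hqt
  refine Finset.sum_lt_sum (fun b _ => ?_) ⟨a, Finset.mem_univ a, ?_⟩
  · exact mul_le_mul_of_nonneg_left (Real.log_le_sub_one_of_pos (div_pos (hq b) (ht b))) (hw b).le
  · refine mul_lt_mul_of_pos_left (Real.log_lt_sub_one_of_pos (div_pos (hq a) (ht a)) ?_) (hw a)
    rwa [Ne, div_eq_one_iff_eq (ht a).ne']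

/-- The tilt by `Q / lam` is the unique maximizer of the within-task objective over strictly
positive probability vectors. -/
theorem objective_lt_objective_tilt [Nonempty A] (i : AlgIndex) {p : A → ℝ} (hp : ∀ a, 0 < p a)
    (hp1 : ∑ a, p a = 1) {Q q : A → ℝ} {lam : ℝ} (hlam : 0 < lam) (hq : ∀ a, 0 < q a)
    (hq1 : ∑ a, q a = 1) (hne : q ≠ tilt i p fun a => Q a / lam) :
    ∑ a, q a * Q a - lam * i.distSq p q <
      ∑ a, tilt i p (fun a => Q a / lam) a * Q a -
        lam * i.distSq p (tilt i p fun a => Q a / lam) := by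
  set z : A → ℝ := fun a => Q a / lam with hz
  set t := tilt i p z with ht
  have htpos : ∀ a, 0 < t a := tilt_pos i hp hp1 z
  have ht1 : ∑ a, t a = 1 := sum_tilt i hp hp1 z
  have hQ : ∀ a, Q a = lam * z a := fun a => by
    rw [hz]
    field_simp
  suffices h : ∑ a, q a * z a - i.distSq p q < ∑ a, t a * z a - i.distSq p t by
    have h2 := mul_lt_mul_of_pos_left h hlam
    simp only [mul_sub, Finset.mul_sum] at h2
    simp only [hQ]
    convert! h2 using 3
    · ring
    · ring
  cases i with
  | one =>
    -- Concavity of `log` at `t`; the tangent is `∑ (q - t) (m - z)`, and `∑ (q - t) m = 0`.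
    obtain ⟨hm, -⟩ := isTiltShift_tiltShift hp hp1 z
    set m := tiltShift p z
    have h1 := sum_mul_log_div_lt hp hq htpos hne
    have h2 : ∑ a, p a * (q a / t a - 1) = -∑ a, q a * z a + ∑ a, t a * z a := by
      have : ∀ a, p a * (q a / t a - 1) = m * q a - m * t a + (t a * z a - q a * z a) := by
        intro a
        have h3 : t a = p a / (m - z a) := rfl
        have h4 : m - z a ≠ 0 := (sub_pos.2 (hm a)).ne'
        have h5 := (hp a).ne'
        rw [h3]
        field_simp
        ring
      simp only [this, Finset.sum_add_distrib, Finset.sum_sub_distrib, ← Finset.mul_sum, hq1, ht1]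
      ring
    have h3 : ∑ a, p a * Real.log (q a / t a) =
        ∑ a, p a * Real.log (p a / t a) - ∑ a, p a * Real.log (p a / q a) := by
      rw [← Finset.sum_sub_distrib]
      refine Finset.sum_congr rfl fun a _ => ?_
      rw [Real.log_div (hq a).ne' (htpos a).ne', Real.log_div (hp a).ne' (htpos a).ne',
        Real.log_div (hp a).ne' (hq a).ne']
      ring
    simp only [AlgIndex.distSq, klFin]
    linarith
  | two =>
    -- The objective at `q` is `log N - KL(q ‖ t)` with `N` the normalizing sum.
    have hNpos : 0 < ∑ b, p b * Real.exp (z b) :=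
      Finset.sum_pos (fun b _ => mul_pos (hp b) (Real.exp_pos _)) Finset.univ_nonempty
    set N := ∑ b, p b * Real.exp (z b)
    have hlog : ∀ a, Real.log (t a) = Real.log (p a) + z a - Real.log N := by
      intro a
      have h3 : t a = p a * Real.exp (z a) / N := rfl
      rw [h3, Real.log_div (mul_pos (hp a) (Real.exp_pos _)).ne' hNpos.ne',
        Real.log_mul (hp a).ne' (Real.exp_pos _).ne', Real.log_exp]
    have hobj : ∀ r : A → ℝ, (∀ a, 0 < r a) → ∑ a, r a = 1 →
        ∑ a, r a * z a - AlgIndex.two.distSq p r =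
          Real.log N + ∑ a, r a * Real.log (t a / r a) := by
      intro r hr hr1
      simp only [AlgIndex.distSq, klFin]
      rw [← one_mul (Real.log N), ← hr1, Finset.sum_mul, ← Finset.sum_sub_distrib,
        ← Finset.sum_add_distrib]
      refine Finset.sum_congr rfl fun a _ => ?_
      rw [Real.log_div (hr a).ne' (hp a).ne', Real.log_div (htpos a).ne' (hr a).ne', hlog]
      ring
    rw [hobj q hq hq1, hobj t htpos ht1]
    have h1 := sum_mul_log_div_lt hq htpos hq hne.symm
    have h2 : ∑ a, q a * (t a / q a - 1) = 0 := by
      have : ∀ a, q a * (t a / q a - 1) = t a - q a := fun a => by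
        have := (hq a).ne'
        field_simp
      simp only [this, Finset.sum_sub_distrib, hq1, ht1, sub_self]
    have h3 : ∑ a, t a * Real.log (t a / t a) = 0 :=
      Finset.sum_eq_zero fun a _ => by rw [div_self (htpos a).ne', Real.log_one, mul_zero]
    linarith

section Smooth

variable {E : Type*} [NormedAddCommGroup E] [NormedSpace ℝ E] {n : WithTop ℕ∞}

/-- The normalizing shift is smooth in `(p, z)` by the implicit function theorem: the derivative of
`∑ a, p a / (m - z a)` in `m` is negative, and uniqueness of the root identifies the implicit
function with `tiltShift`. -/
theorem contDiffAt_tiltShift_prod [Nonempty A] (hn : n ≠ 0) {p z : A → ℝ} (hp : ∀ a, 0 < p a)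
    (hp1 : ∑ a, p a = 1) :
    ContDiffAt ℝ n (fun x : (A → ℝ) × (A → ℝ) => tiltShift x.1 x.2) (p, z) := by
  set m := tiltShift p z with hm
  obtain ⟨hlt, hsum⟩ := isTiltShift_tiltShift hp hp1 z
  rw [← hm] at hlt hsum
  set f : ((A → ℝ) × (A → ℝ)) × ℝ → ℝ := fun v => ∑ a, v.1.1 a / (v.2 - v.1.2 a) with hf
  set u : ((A → ℝ) × (A → ℝ)) × ℝ := ((p, z), m) with hu
  have hne : ∀ a, u.2 - u.1.2 a ≠ 0 := fun a => (sub_pos.2 (hlt a)).ne'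
  have cdf : ContDiffAt ℝ n f u := by
    refine ContDiffAt.sum fun a _ => ContDiffAt.div ?_ ?_ (hne a) <;> fun_prop
  have hderiv : HasDerivAt (fun k : ℝ => f ((p, z), k)) (∑ a, -p a / (m - z a) ^ 2) m := by
    refine HasDerivAt.fun_sum fun a _ => ?_
    have h1 := (((hasDerivAt_id m).sub_const (z a)).inv (hne a)).const_mul (p a)
    simp only [div_eq_mul_inv]
    convert! h1 using 1
    simp only [id]
    ring
  have hneg : ∑ a, -p a / (m - z a) ^ 2 ≠ 0 :=
    (Finset.sum_neg (fun a _ => div_neg_of_neg_of_pos (neg_lt_zero.2 (hp a))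
      (pow_pos (sub_pos.2 (hlt a)) 2)) Finset.univ_nonempty).ne
  have hinv : (fderiv ℝ f u ∘L .inr ℝ ((A → ℝ) × (A → ℝ)) ℝ).IsInvertible := by
    refine ⟨ContinuousLinearEquiv.unitsEquivAut ℝ (Units.mk0 _ hneg), ?_⟩
    have h1 : HasFDerivAt (fun k : ℝ => f ((p, z), k))
        (fderiv ℝ f u ∘L .inr ℝ ((A → ℝ) × (A → ℝ)) ℝ) m :=
      (cdf.differentiableAt hn).hasFDerivAt.comp m (hasFDerivAt_prodMk_right (p, z) m)
    have h2 := h1.unique hderiv.hasFDerivAt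
    rw [h2]
    ext
    simp
  have hψ := cdf.contDiffAt_implicitFunction hn hinv
  refine hψ.congr_of_eventuallyEq ?_
  have hψu : cdf.implicitFunction hn hinv (p, z) = m := cdf.implicitFunction_apply_self hn hinv
  have hpos : ∀ᶠ x : (A → ℝ) × (A → ℝ) in nhds (p, z),
      ∀ a, 0 < x.1 a ∧ x.2 a < cdf.implicitFunction hn hinv x := by
    rw [Filter.eventually_all]
    intro a
    refine Filter.Eventually.and ?_ ?_
    · exact continuousAt_const.eventually_lt (by fun_prop) (hp a)
    · refine ContinuousAt.eventually_lt (by fun_prop) hψ.continuousAt ?_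
      change z a < cdf.implicitFunction hn hinv (p, z)
      rw [hψu]
      exact hlt a
  filter_upwards [cdf.eventually_apply_implicitFunction hn hinv, hpos] with x hx hxpos
  have hx' : IsTiltShift x.1 x.2 (cdf.implicitFunction hn hinv x) :=
    ⟨fun a => (hxpos a).2, hx.trans hsum⟩
  exact IsTiltShift.unique (fun a => (hxpos a).1) (Classical.epsilon_spec ⟨_, hx'⟩) hx'

theorem contDiffAt_tiltShift [Nonempty A] (hn : n ≠ 0) {p z : E → A → ℝ} {x : E}
    (hp : ∀ a, 0 < p x a) (hp1 : ∑ a, p x a = 1)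
    (dp : ∀ a, ContDiffAt ℝ n (fun y => p y a) x) (dz : ∀ a, ContDiffAt ℝ n (fun y => z y a) x) :
    ContDiffAt ℝ n (fun y => tiltShift (p y) (z y)) x :=
  ContDiffAt.comp (g := fun y : (A → ℝ) × (A → ℝ) => tiltShift y.1 y.2) x
    (contDiffAt_tiltShift_prod hn hp hp1) ((contDiffAt_pi.2 dp).prodMk (contDiffAt_pi.2 dz))

theorem contDiffAt_tilt [Nonempty A] (hn : n ≠ 0) (i : AlgIndex) {p z : E → A → ℝ} {x : E}
    (hp : ∀ a, 0 < p x a) (hp1 : ∑ a, p x a = 1)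
    (dp : ∀ a, ContDiffAt ℝ n (fun y => p y a) x) (dz : ∀ a, ContDiffAt ℝ n (fun y => z y a) x)
    (a : A) : ContDiffAt ℝ n (fun y => tilt i (p y) (z y) a) x := by
  cases i with
  | one =>
    exact (dp a).div ((contDiffAt_tiltShift hn hp hp1 dp dz).sub (dz a))
      (sub_pos.2 ((isTiltShift_tiltShift hp hp1 (z x)).1 a)).ne'
  | two =>
    refine ContDiffAt.div ((dp a).mul (dz a).exp) (ContDiffAt.sum fun b _ => (dp b).mul (dz b).exp)
      (Finset.sum_pos (fun b _ => mul_pos (hp b) (Real.exp_pos _)) Finset.univ_nonempty).ne'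

end Smooth

end Response

/-! ### The adapted policy in closed form -/

section Softmax

variable {S A : Type*} [Fintype A]

/-- Every strictly positive policy is a softmax policy, with parameter `log π`. -/
theorem exists_softmaxPolicy_eq {π : S → A → ℝ} (hpos : ∀ s a, 0 < π s a)
    (hsum : ∀ s, ∑ a, π s a = 1) : ∃ θ : Param S A, softmaxPolicy θ = π := by
  refine ⟨WithLp.toLp 2 fun x => Real.log (π x.1 x.2), ?_⟩
  funext s a
  simp [softmaxPolicy, Real.exp_log (hpos s _), hsum]

variable [Nonempty A]

theorem softmaxPolicy_pos (θ : Param S A) (s : S) (a : A) : 0 < softmaxPolicy θ s a :=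
  div_pos (Real.exp_pos _) (Finset.sum_pos (fun _ _ => Real.exp_pos _) Finset.univ_nonempty)

theorem sum_softmaxPolicy (θ : Param S A) (s : S) : ∑ a, softmaxPolicy θ s a = 1 := by
  simp only [softmaxPolicy]
  rw [← Finset.sum_div, div_self]
  exact (Finset.sum_pos (fun _ _ => Real.exp_pos _) Finset.univ_nonempty).ne'

theorem softmaxPolicy_mem_stdSimplex (θ : Param S A) (s : S) :
    softmaxPolicy θ s ∈ stdSimplex ℝ A :=
  ⟨fun a => (softmaxPolicy_pos θ s a).le, sum_softmaxPolicy θ s⟩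

theorem mem_range_softmaxPolicy {s : S} {q : A → ℝ} :
    q ∈ Set.range (fun θ : Param S A => softmaxPolicy θ s) ↔ (∀ a, 0 < q a) ∧ ∑ a, q a = 1 := by
  constructor
  · rintro ⟨θ, rfl⟩
    exact ⟨softmaxPolicy_pos θ s, sum_softmaxPolicy θ s⟩
  · rintro ⟨hpos, hsum⟩
    obtain ⟨θ, hθ⟩ := exists_softmaxPolicy_eq (S := S) (π := fun _ => q) (fun _ => hpos)
      fun _ => hsum
    exact ⟨θ, congrFun hθ s⟩

theorem contDiffAt_softmaxPolicy [Fintype S] {E : Type*} [NormedAddCommGroup E]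
    [NormedSpace ℝ E] {n : WithTop ℕ∞} {φ : E → Param S A} {x : E} (dφ : ContDiffAt ℝ n φ x)
    (s : S) (a : A) : ContDiffAt ℝ n (fun y => softmaxPolicy (φ y) s a) x := by
  have h : ∀ c : S × A, ContDiffAt ℝ n (fun y => φ y c) x := fun c =>
    (contDiffAt_piLp 2).1 dφ c
  exact ContDiffAt.div (h _).exp (ContDiffAt.sum fun b _ => (h _).exp)
    (Finset.sum_pos (fun _ _ => Real.exp_pos _) Finset.univ_nonempty).ne'

end Softmax

section Adapted

variable {S A : Type*} [Fintype S] [Fintype A] [DecidableEq S] [Nonempty A]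

/-- The adapted policy in closed form: the tilt of `π_φ(· | s)` by `Q^{π_φ}(s, ·) / lam`. -/
noncomputable def tiltPolicy (i : AlgIndex) (γ lam : ℝ) (T R : S → A → S → ℝ) (φ : Param S A)
    (s : S) : A → ℝ :=
  tilt i (softmaxPolicy φ s) fun a => bellmanQ γ T R (softmaxPolicy φ) s a / lam

theorem tiltPolicy_pos (i : AlgIndex) (γ lam : ℝ) (T R : S → A → S → ℝ) (φ : Param S A)
    (s : S) (a : A) : 0 < tiltPolicy i γ lam T R φ s a :=
  tilt_pos i (softmaxPolicy_pos φ s) (sum_softmaxPolicy φ s) _ a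

theorem sum_tiltPolicy (i : AlgIndex) (γ lam : ℝ) (T R : S → A → S → ℝ) (φ : Param S A)
    (s : S) : ∑ a, tiltPolicy i γ lam T R φ s a = 1 :=
  sum_tilt i (softmaxPolicy_pos φ s) (sum_softmaxPolicy φ s) _

theorem tiltPolicy_mem_stdSimplex (i : AlgIndex) (γ lam : ℝ) (T R : S → A → S → ℝ)
    (φ : Param S A) (s : S) : tiltPolicy i γ lam T R φ s ∈ stdSimplex ℝ A :=
  ⟨fun a => (tiltPolicy_pos i γ lam T R φ s a).le, sum_tiltPolicy i γ lam T R φ s⟩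

section ClosedForm

variable [DecidableEq A] {γ rmax lam : ℝ}

theorem isAdapted_iff_eq_tiltPolicy (hγ₀ : 0 ≤ γ) (hγ₁ : γ < 1) (hlam : 0 < lam) (i : AlgIndex)
    (M : TaskMDP S A rmax) (φ : Param S A) (s : S) (q : A → ℝ) :
    IsAdapted i γ lam M φ s q ↔ q = tiltPolicy i γ lam M.trans M.reward φ s := by
  have hlt : ∀ q' : A → ℝ, (∀ a, 0 < q' a) → ∑ a, q' a = 1 →
      q' ≠ tiltPolicy i γ lam M.trans M.reward φ s →
      adaptObjective i γ lam M φ s q' <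
        adaptObjective i γ lam M φ s (tiltPolicy i γ lam M.trans M.reward φ s) := by
    intro q' hq' hq'1 hne
    simp only [adaptObjective, qFn_eq_bellmanQ hγ₀ hγ₁ M (softmaxPolicy_mem_stdSimplex φ)]
    exact objective_lt_objective_tilt i (softmaxPolicy_pos φ s) (sum_softmaxPolicy φ s) hlam hq'
      hq'1 hne
  have hmem : tiltPolicy i γ lam M.trans M.reward φ s ∈
      Set.range (fun θ : Param S A => softmaxPolicy θ s) :=
    mem_range_softmaxPolicy.2 ⟨tiltPolicy_pos _ _ _ _ _ _ _, sum_tiltPolicy _ _ _ _ _ _ _⟩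
  constructor
  · rintro ⟨hq, hmax⟩
    by_contra hne
    obtain ⟨hq0, hq1⟩ := mem_range_softmaxPolicy.1 hq
    exact (hlt q hq0 hq1 hne).not_ge (hmax hmem)
  · rintro rfl
    refine ⟨hmem, fun q' hq' => ?_⟩
    obtain ⟨hq0, hq1⟩ := mem_range_softmaxPolicy.1 hq'
    by_cases hne : q' = tiltPolicy i γ lam M.trans M.reward φ s
    · subst hne
      exact le_refl (adaptObjective i γ lam M φ s _)
    · exact (hlt q' hq0 hq1 hne).le

theorem alg_eq_tiltPolicy (hγ₀ : 0 ≤ γ) (hγ₁ : γ < 1) (hlam : 0 < lam) (i : AlgIndex)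
    (M : TaskMDP S A rmax) (φ : Param S A) :
    alg i γ lam M φ = tiltPolicy i γ lam M.trans M.reward φ := by
  funext s
  have h := isAdapted_iff_eq_tiltPolicy hγ₀ hγ₁ hlam i M φ s
  exact (h _).1 (Classical.epsilon_spec ⟨_, (h _).2 rfl⟩)

end ClosedForm

/-- `adaptedReward` as an expression in the raw data of a task, on which smoothness and joint
continuity in the task and the parameter can be read off. -/
noncomputable def rawReward (i : AlgIndex) (γ lam : ℝ) (ρ : S → ℝ) (T R : S → A → S → ℝ)
    (φ : Param S A) : ℝ :=
  ∑ s, ρ s * bellmanValue γ T R (tiltPolicy i γ lam T R φ) s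

theorem adaptedReward_eq_rawReward [DecidableEq A] {γ rmax lam : ℝ} (hγ₀ : 0 ≤ γ) (hγ₁ : γ < 1)
    (hlam : 0 < lam) (i : AlgIndex) (M : TaskMDP S A rmax) :
    adaptedReward i γ lam M = rawReward i γ lam M.init M.trans M.reward := by
  funext φ
  rw [adaptedReward, accReward, alg_eq_tiltPolicy hγ₀ hγ₁ hlam, rawReward]
  refine Finset.sum_congr rfl fun s _ => ?_
  rw [valueFn_eq_bellmanValue hγ₀ hγ₁ M]
  exact tiltPolicy_mem_stdSimplex _ _ _ _ _ _

section Smooth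

variable {E : Type*} [NormedAddCommGroup E] [NormedSpace ℝ E] {n : WithTop ℕ∞} {γ lam : ℝ}
  {ρ : E → S → ℝ} {T R : E → S → A → S → ℝ} {φ : E → Param S A} {x : E}

theorem contDiffAt_tiltPolicy (hn : n ≠ 0) (i : AlgIndex) (hγ₀ : 0 ≤ γ) (hγ₁ : γ < 1)
    (hT : ∀ s a, T x s a ∈ stdSimplex ℝ S)
    (dT : ∀ s a s', ContDiffAt ℝ n (fun y => T y s a s') x)
    (dR : ∀ s a s', ContDiffAt ℝ n (fun y => R y s a s') x)
    (dφ : ContDiffAt ℝ n φ x) (s : S) (a : A) :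
    ContDiffAt ℝ n (fun y => tiltPolicy i γ lam (T y) (R y) (φ y) s a) x :=
  contDiffAt_tilt (p := fun y => softmaxPolicy (φ y) s)
    (z := fun y b => bellmanQ γ (T y) (R y) (softmaxPolicy (φ y)) s b / lam) hn i
    (softmaxPolicy_pos _ s) (sum_softmaxPolicy _ s) (contDiffAt_softmaxPolicy dφ s)
    (fun b => (contDiffAt_bellmanQ (π := fun y => softmaxPolicy (φ y)) hγ₀ hγ₁ hT
      (softmaxPolicy_mem_stdSimplex _) dT dR (contDiffAt_softmaxPolicy dφ) s b).div_const lam) a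

theorem contDiffAt_rawReward (hn : n ≠ 0) (i : AlgIndex) (hγ₀ : 0 ≤ γ) (hγ₁ : γ < 1)
    (hT : ∀ s a, T x s a ∈ stdSimplex ℝ S)
    (dρ : ∀ s, ContDiffAt ℝ n (fun y => ρ y s) x)
    (dT : ∀ s a s', ContDiffAt ℝ n (fun y => T y s a s') x)
    (dR : ∀ s a s', ContDiffAt ℝ n (fun y => R y s a s') x)
    (dφ : ContDiffAt ℝ n φ x) :
    ContDiffAt ℝ n (fun y => rawReward i γ lam (ρ y) (T y) (R y) (φ y)) x :=
  ContDiffAt.sum fun s _ => (dρ s).mul (contDiffAt_bellmanValue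
    (π := fun y => tiltPolicy i γ lam (T y) (R y) (φ y)) hγ₀ hγ₁ hT
    (tiltPolicy_mem_stdSimplex i γ lam _ _ _) dT dR
    (contDiffAt_tiltPolicy hn i hγ₀ hγ₁ hT dT dR dφ) s)

end Smooth

end Adapted

/-! ### Values along a path of policies -/

theorem ContDiff.hasDerivAt_deriv_two {f : ℝ → ℝ} (hf : ContDiff ℝ 2 f) (t : ℝ) :
    HasDerivAt f (deriv f t) t ∧ HasDerivAt (deriv f) (deriv (deriv f) t) t := by
  have h1 : ContDiff ℝ 1 (deriv f) :=
    ((contDiff_succ_iff_deriv (n := 1)).1 (by simpa using! hf)).2.2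
  exact ⟨(hf.differentiable (by norm_num) t).hasDerivAt,
    (h1.differentiable (by norm_num) t).hasDerivAt⟩

section ValuePath

variable {S A : Type*} [Fintype S] [Fintype A] [DecidableEq S]
  {γ r : ℝ} {T R : S → A → S → ℝ}

theorem abs_bellmanValue_le (hγ₀ : 0 ≤ γ) (hγ₁ : γ < 1) (hT : ∀ s a, T s a ∈ stdSimplex ℝ S)
    (hR : ∀ s a s', |R s a s'| ≤ r) {π : S → A → ℝ} (hπ : ∀ s, π s ∈ stdSimplex ℝ A) (s : S) :
    |bellmanValue γ T R π s| ≤ r / (1 - γ) := by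
  refine abs_le_div_of_abs_le_add hγ₀ hγ₁ (x := bellmanValue γ T R π)
    (y := fun s => ∑ a, π s a * ∑ s', T s a s' * bellmanValue γ T R π s')
    (fun s c hc => abs_sum_le_of_mem_stdSimplex (hπ s) fun a =>
      abs_sum_le_of_mem_stdSimplex (hT s a) hc) (fun s => ?_) s
  have h1 : bellmanValue γ T R π s = ∑ a, π s a * ∑ s', T s a s' * R s a s' +
      γ * ∑ a, π s a * ∑ s', T s a s' * bellmanValue γ T R π s' := by
    conv_lhs => rw [bellmanValue_eq hγ₀ hγ₁ hT R hπ s]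
    simp only [bellmanQ, mul_add, Finset.sum_add_distrib, Finset.mul_sum]
    congr 1
    exact Finset.sum_congr rfl fun a _ => Finset.sum_congr rfl fun s' _ => by ring
  rw [h1]
  refine (abs_add_le _ _).trans (add_le_add ?_ ?_)
  · exact abs_sum_le_of_mem_stdSimplex (hπ s) fun a =>
      abs_sum_le_of_mem_stdSimplex (hT s a) (hR s a)
  · rw [abs_mul, abs_of_nonneg hγ₀]

theorem abs_bellmanQ_le (hγ₀ : 0 ≤ γ) (hγ₁ : γ < 1) (hT : ∀ s a, T s a ∈ stdSimplex ℝ S)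
    (hR : ∀ s a s', |R s a s'| ≤ r) {π : S → A → ℝ} (hπ : ∀ s, π s ∈ stdSimplex ℝ A) (s : S)
    (a : A) : |bellmanQ γ T R π s a| ≤ r / (1 - γ) := by
  refine abs_sum_le_of_mem_stdSimplex (hT s a) fun s' => ?_
  have h1 := abs_bellmanValue_le hγ₀ hγ₁ hT hR hπ s'
  have h2 : r / (1 - γ) = r + γ * (r / (1 - γ)) := by
    have : 1 - γ ≠ 0 := by linarith
    field_simp
    ring
  rw [h2]
  refine (abs_add_le _ _).trans (add_le_add (hR s a s') ?_)
  rw [abs_mul, abs_of_nonneg hγ₀]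
  exact mul_le_mul_of_nonneg_left h1 hγ₀

variable {π : ℝ → S → A → ℝ}

theorem contDiff_bellmanValue_path (hγ₀ : 0 ≤ γ) (hγ₁ : γ < 1)
    (hT : ∀ s a, T s a ∈ stdSimplex ℝ S) (hπ : ∀ t s, π t s ∈ stdSimplex ℝ A)
    (dπ : ∀ s a, ContDiff ℝ 2 fun t => π t s a) (s : S) :
    ContDiff ℝ 2 fun t => bellmanValue γ T R (π t) s :=
  contDiff_iff_contDiffAt.2 fun t => contDiffAt_bellmanValue (T := fun _ => T) (R := fun _ => R)
    hγ₀ hγ₁ hT (hπ t) (fun _ _ _ => contDiffAt_const) (fun _ _ _ => contDiffAt_const)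
    (fun s a => (dπ s a).contDiffAt) s

theorem contDiff_bellmanQ_path (hγ₀ : 0 ≤ γ) (hγ₁ : γ < 1)
    (hT : ∀ s a, T s a ∈ stdSimplex ℝ S) (hπ : ∀ t s, π t s ∈ stdSimplex ℝ A)
    (dπ : ∀ s a, ContDiff ℝ 2 fun t => π t s a) (s : S) (a : A) :
    ContDiff ℝ 2 fun t => bellmanQ γ T R (π t) s a :=
  contDiff_iff_contDiffAt.2 fun t => contDiffAt_bellmanQ (T := fun _ => T) (R := fun _ => R)
    hγ₀ hγ₁ hT (hπ t) (fun _ _ _ => contDiffAt_const) (fun _ _ _ => contDiffAt_const)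
    (fun s a => (dπ s a).contDiffAt) s a

theorem deriv_bellmanQ_path (hγ₀ : 0 ≤ γ) (hγ₁ : γ < 1)
    (hT : ∀ s a, T s a ∈ stdSimplex ℝ S) (hπ : ∀ t s, π t s ∈ stdSimplex ℝ A)
    (dπ : ∀ s a, ContDiff ℝ 2 fun t => π t s a) (s : S) (a : A) :
    deriv (fun t => bellmanQ γ T R (π t) s a) =
      (fun t => γ * ∑ s', T s a s' * deriv (fun t => bellmanValue γ T R (π t) s') t) ∧
    deriv (deriv fun t => bellmanQ γ T R (π t) s a) =
      fun t => γ * ∑ s', T s a s' * deriv (deriv fun t => bellmanValue γ T R (π t) s') t := by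
  have hV := fun s t =>
    (contDiff_bellmanValue_path (R := R) hγ₀ hγ₁ hT hπ dπ s).hasDerivAt_deriv_two t
  have h1 : deriv (fun t => bellmanQ γ T R (π t) s a) =
      (fun t => γ * ∑ s', T s a s' * deriv (fun t => bellmanValue γ T R (π t) s') t) := by
    funext t
    refine HasDerivAt.deriv ?_
    have : HasDerivAt (fun t => bellmanQ γ T R (π t) s a)
        (∑ s', T s a s' * (γ * deriv (fun t => bellmanValue γ T R (π t) s') t)) t :=
      HasDerivAt.fun_sum fun s' _ => (((hV s' t).1.const_mul γ).const_add _).const_mul _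
    convert! this using 1
    rw [Finset.mul_sum]
    exact Finset.sum_congr rfl fun s' _ => by ring
  refine ⟨h1, ?_⟩
  rw [h1]
  funext t
  exact ((HasDerivAt.fun_sum fun s' _ => (hV s' t).2.const_mul (T s a s')).const_mul γ).deriv

/-- First-order bound on the value along a path of policies: `V' = ∑ π' Q + γ P_π V'`, and the
maximum principle. -/
theorem abs_deriv_bellmanValue_le (hγ₀ : 0 ≤ γ) (hγ₁ : γ < 1)
    (hT : ∀ s a, T s a ∈ stdSimplex ℝ S) (hπ : ∀ t s, π t s ∈ stdSimplex ℝ A)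
    (dπ : ∀ s a, ContDiff ℝ 2 fun t => π t s a) {κ t : ℝ}
    (hκ : ∀ s, |∑ a, deriv (fun t => π t s a) t * bellmanQ γ T R (π t) s a| ≤ κ) (s : S) :
    |deriv (fun t => bellmanValue γ T R (π t) s) t| ≤ κ / (1 - γ) := by
  refine abs_le_div_of_abs_le_add hγ₀ hγ₁
    (x := fun s => deriv (fun t => bellmanValue γ T R (π t) s) t)
    (y := fun s => ∑ a, π t s a * ∑ s', T s a s' * deriv (fun t => bellmanValue γ T R (π t) s') t)
    (fun s c hc => abs_sum_le_of_mem_stdSimplex (hπ t s) fun a =>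
      abs_sum_le_of_mem_stdSimplex (hT s a) hc) (fun s => ?_) s
  have hQ := fun a => (contDiff_bellmanQ_path (R := R) hγ₀ hγ₁ hT hπ dπ s a).hasDerivAt_deriv_two t
  have h1 : deriv (fun t => bellmanValue γ T R (π t) s) t =
      ∑ a, deriv (fun t => π t s a) t * bellmanQ γ T R (π t) s a +
      γ * ∑ a, π t s a * ∑ s', T s a s' * deriv (fun t => bellmanValue γ T R (π t) s') t := by
    have h2 : HasDerivAt (fun t => bellmanValue γ T R (π t) s)
        (∑ a, (deriv (fun t => π t s a) t * bellmanQ γ T R (π t) s a +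
          π t s a * deriv (fun t => bellmanQ γ T R (π t) s a) t)) t := by
      simp only [funext fun t => bellmanValue_eq hγ₀ hγ₁ hT R (hπ t) s]
      exact HasDerivAt.fun_sum fun a _ => ((dπ s a).hasDerivAt_deriv_two t).1.mul (hQ a).1
    rw [h2.deriv, Finset.sum_add_distrib, Finset.mul_sum]
    congr 1
    refine Finset.sum_congr rfl fun a _ => ?_
    rw [(deriv_bellmanQ_path hγ₀ hγ₁ hT hπ dπ s a).1]
    ring
  rw [h1]
  refine (abs_add_le _ _).trans (add_le_add (hκ s) ?_)
  rw [abs_mul, abs_of_nonneg hγ₀]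

theorem abs_sum_mul_le_of_sum_abs_le {ι : Type*} [Fintype ι] {x y : ι → ℝ} {c k : ℝ}
    (hx : ∑ i, |x i| ≤ c) (hk : 0 ≤ k) (hy : ∀ i, |y i| ≤ k) : |∑ i, x i * y i| ≤ c * k := by
  calc |∑ i, x i * y i| ≤ ∑ i, |x i * y i| := Finset.abs_sum_le_sum_abs _ _
    _ ≤ ∑ i, |x i| * k := Finset.sum_le_sum fun i _ => by
        rw [abs_mul]
        exact mul_le_mul_of_nonneg_left (hy i) (abs_nonneg _)
    _ ≤ c * k := by
        rw [← Finset.sum_mul]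
        exact mul_le_mul_of_nonneg_right hx hk

/-- Since `∑ π' = 0`, only the advantage enters the first derivative of the value. -/
theorem abs_deriv_bellmanValue_le_of_advantage (hγ₀ : 0 ≤ γ) (hγ₁ : γ < 1)
    (hT : ∀ s a, T s a ∈ stdSimplex ℝ S) (hπ : ∀ t s, π t s ∈ stdSimplex ℝ A)
    (dπ : ∀ s a, ContDiff ℝ 2 fun t => π t s a) {c k t : ℝ} (hk : 0 ≤ k)
    (hadv : ∀ s a, |bellmanQ γ T R (π t) s a - bellmanValue γ T R (π t) s| ≤ k)
    (hc : ∀ s, ∑ a, |deriv (fun t => π t s a) t| ≤ c)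
    (s : S) : |deriv (fun t => bellmanValue γ T R (π t) s) t| ≤ c * k / (1 - γ) := by
  refine abs_deriv_bellmanValue_le hγ₀ hγ₁ hT hπ dπ (fun s => ?_) s
  have hsum : ∑ a, deriv (fun t => π t s a) t = 0 := by
    have h1 : HasDerivAt (fun t => ∑ a, π t s a) (∑ a, deriv (fun t => π t s a) t) t :=
      HasDerivAt.fun_sum fun a _ => ((dπ s a).hasDerivAt_deriv_two t).1
    simp only [(hπ _ s).2] at h1
    exact h1.unique (hasDerivAt_const t 1)
  have h2 : ∑ a, deriv (fun t => π t s a) t * bellmanQ γ T R (π t) s a =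
      ∑ a, deriv (fun t => π t s a) t *
        (bellmanQ γ T R (π t) s a - bellmanValue γ T R (π t) s) := by
    simp only [mul_sub, Finset.sum_sub_distrib, ← Finset.sum_mul, hsum, zero_mul, sub_zero]
  rw [h2]
  exact abs_sum_mul_le_of_sum_abs_le (hc s) hk (hadv s)

/-- Second-order bound on the value along a path of policies:
`V'' = ∑ π'' Q + 2 ∑ π' Q' + γ P_π V''`, and the maximum principle. -/
theorem abs_deriv_deriv_bellmanValue_le (hγ₀ : 0 ≤ γ) (hγ₁ : γ < 1)
    (hT : ∀ s a, T s a ∈ stdSimplex ℝ S) (hR : ∀ s a s', |R s a s'| ≤ r)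
    (hr : 0 ≤ r) (hπ : ∀ t s, π t s ∈ stdSimplex ℝ A)
    (dπ : ∀ s a, ContDiff ℝ 2 fun t => π t s a) {c₁ c₂ t : ℝ} (hc₁0 : 0 ≤ c₁)
    (hc₁ : ∀ s, ∑ a, |deriv (fun t => π t s a) t| ≤ c₁)
    (hc₂ : ∀ s, ∑ a, |deriv (deriv fun t => π t s a) t| ≤ c₂) (s : S) :
    |deriv (deriv fun t => bellmanValue γ T R (π t) s) t| ≤
      (c₂ * (r / (1 - γ)) + 2 * (c₁ * (γ * (c₁ * (r / (1 - γ)) / (1 - γ))))) / (1 - γ) := by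
  have hd : 0 < 1 - γ := by linarith
  have hr' : 0 ≤ r / (1 - γ) := by positivity
  refine abs_le_div_of_abs_le_add hγ₀ hγ₁
    (x := fun s => deriv (deriv fun t => bellmanValue γ T R (π t) s) t)
    (y := fun s => ∑ a, π t s a * ∑ s', T s a s' *
      deriv (deriv fun t => bellmanValue γ T R (π t) s') t)
    (fun s c hc => abs_sum_le_of_mem_stdSimplex (hπ t s) fun a =>
      abs_sum_le_of_mem_stdSimplex (hT s a) hc) (fun s => ?_) s
  have hV' : ∀ s, |deriv (fun t => bellmanValue γ T R (π t) s) t| ≤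
      c₁ * (r / (1 - γ)) / (1 - γ) :=
    abs_deriv_bellmanValue_le hγ₀ hγ₁ hT hπ dπ fun s =>
      abs_sum_mul_le_of_sum_abs_le (hc₁ s) hr' (abs_bellmanQ_le hγ₀ hγ₁ hT hR (hπ t) s)
  have hQ' : ∀ a, |deriv (fun t => bellmanQ γ T R (π t) s a) t| ≤
      γ * (c₁ * (r / (1 - γ)) / (1 - γ)) := by
    intro a
    rw [(deriv_bellmanQ_path hγ₀ hγ₁ hT hπ dπ s a).1, abs_mul, abs_of_nonneg hγ₀]
    exact mul_le_mul_of_nonneg_left (abs_sum_le_of_mem_stdSimplex (hT s a) hV') hγ₀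
  have hQ := fun a t =>
    (contDiff_bellmanQ_path (R := R) hγ₀ hγ₁ hT hπ dπ s a).hasDerivAt_deriv_two t
  have hp := fun a t => (dπ s a).hasDerivAt_deriv_two t
  have h1 : deriv (fun t => bellmanValue γ T R (π t) s) = fun t =>
      ∑ a, (deriv (fun t => π t s a) t * bellmanQ γ T R (π t) s a +
        π t s a * deriv (fun t => bellmanQ γ T R (π t) s a) t) := by
    funext t
    simp only [funext fun t => bellmanValue_eq hγ₀ hγ₁ hT R (hπ t) s]
    exact (HasDerivAt.fun_sum fun a _ => (hp a t).1.mul (hQ a t).1).deriv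
  have h2 : deriv (deriv fun t => bellmanValue γ T R (π t) s) t =
      (∑ a, deriv (deriv fun t => π t s a) t * bellmanQ γ T R (π t) s a +
      2 * ∑ a, deriv (fun t => π t s a) t * deriv (fun t => bellmanQ γ T R (π t) s a) t) +
      γ * ∑ a, π t s a * ∑ s', T s a s' *
        deriv (deriv fun t => bellmanValue γ T R (π t) s') t := by
    have h3 : HasDerivAt (fun t => ∑ a, (deriv (fun t => π t s a) t * bellmanQ γ T R (π t) s a +
        π t s a * deriv (fun t => bellmanQ γ T R (π t) s a) t)) _ t :=
      HasDerivAt.fun_sum fun a _ =>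
        ((hp a t).2.mul (hQ a t).1).add ((hp a t).1.mul (hQ a t).2)
    rw [h1, h3.deriv, Finset.mul_sum,
      Finset.mul_sum, ← Finset.sum_add_distrib, ← Finset.sum_add_distrib]
    refine Finset.sum_congr rfl fun a _ => ?_
    rw [(deriv_bellmanQ_path hγ₀ hγ₁ hT hπ dπ s a).2]
    ring
  rw [h2]
  refine (abs_add_le _ _).trans (add_le_add ((abs_add_le _ _).trans (add_le_add ?_ ?_)) ?_)
  · exact abs_sum_mul_le_of_sum_abs_le (hc₂ s) hr' (abs_bellmanQ_le hγ₀ hγ₁ hT hR (hπ t) s)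
  · rw [abs_mul, abs_two]
    exact mul_le_mul_of_nonneg_left (abs_sum_mul_le_of_sum_abs_le (hc₁ s) (by positivity) hQ')
      zero_le_two
  · rw [abs_mul, abs_of_nonneg hγ₀]

end ValuePath

/-! ### Derivative bounds for softmax and tilted policies -/

section PolicyPath

variable {A : Type*} [Fintype A]

/-- A vector that is determined up to a nonnegative direction `k` by `y`, and normalized by
`∑ x = 0`, has at most twice the `ℓ¹` norm of `y`. -/
theorem sum_abs_le_two_mul {x y k : A → ℝ} {c : ℝ} (hk : ∀ a, 0 ≤ k a)
    (hx : ∀ a, x a = y a - k a * c) (hsum : ∑ a, x a = 0) : ∑ a, |x a| ≤ 2 * ∑ a, |y a| := by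
  have h1 : (∑ a, k a) * c = ∑ a, y a := by
    simp only [hx, Finset.sum_sub_distrib, ← Finset.sum_mul] at hsum
    linarith
  have h2 : (∑ a, k a) * |c| ≤ ∑ a, |y a| := by
    rw [← abs_of_nonneg (Finset.sum_nonneg fun a _ => hk a), ← abs_mul, h1]
    exact Finset.abs_sum_le_sum_abs _ _
  have h3 : ∑ a, |x a| ≤ ∑ a, (|y a| + k a * |c|) := Finset.sum_le_sum fun a _ => by
    rw [hx]
    refine (abs_sub _ _).trans (le_of_eq ?_)
    rw [abs_mul, abs_of_nonneg (hk a)]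
  rw [Finset.sum_add_distrib, ← Finset.sum_mul] at h3
  linarith

theorem sum_abs_mul_le {p x : A → ℝ} {c : ℝ} (hp : p ∈ stdSimplex ℝ A) (hx : ∀ a, |x a| ≤ c) :
    ∑ a, |p a * x a| ≤ c := by
  calc ∑ a, |p a * x a| ≤ ∑ a, p a * c := Finset.sum_le_sum fun a _ => by
        rw [abs_mul, abs_of_nonneg (hp.1 a)]
        exact mul_le_mul_of_nonneg_left (hx a) (hp.1 a)
    _ = c := by rw [← Finset.sum_mul, hp.2, one_mul]

theorem sum_deriv_eq_zero {π : ℝ → A → ℝ} (hπ : ∀ t, ∑ a, π t a = 1)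
    (dπ : ∀ a, ContDiff ℝ 2 fun t => π t a) (t : ℝ) :
    ∑ a, deriv (fun t => π t a) t = 0 ∧ ∑ a, deriv (deriv fun t => π t a) t = 0 := by
  have h1 : ∀ t, ∑ a, deriv (fun t => π t a) t = 0 := fun t => by
    have h1 : HasDerivAt (fun t => ∑ a, π t a) (∑ a, deriv (fun t => π t a) t) t :=
      HasDerivAt.fun_sum fun a _ => ((dπ a).hasDerivAt_deriv_two t).1
    simp only [hπ] at h1
    exact h1.unique (hasDerivAt_const t 1)
  refine ⟨h1 t, ?_⟩
  have h2 : HasDerivAt (fun t => ∑ a, deriv (fun t => π t a) t)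
      (∑ a, deriv (deriv fun t => π t a) t) t :=
    HasDerivAt.fun_sum fun a _ => ((dπ a).hasDerivAt_deriv_two t).2
  simp only [h1] at h2
  exact h2.unique (hasDerivAt_const t 0)

/-- Derivative bounds for `π ∝ exp ψ` along a path of preferences `ψ`. -/
theorem sum_abs_deriv_exp_le [Nonempty A] {π ψ : ℝ → A → ℝ}
    (hπ : ∀ t a, π t a = Real.exp (ψ t a) / ∑ b, Real.exp (ψ t b))
    (dψ : ∀ a, ContDiff ℝ 2 fun t => ψ t a) {K₁ K₂ t : ℝ}
    (h₁ : ∀ a, |deriv (fun t => ψ t a) t| ≤ K₁)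
    (h₂ : ∀ a, |deriv (deriv fun t => ψ t a) t| ≤ K₂) :
    ∑ a, |deriv (fun t => π t a) t| ≤ 2 * K₁ ∧
      ∑ a, |deriv (deriv fun t => π t a) t| ≤ 2 * (4 * K₁ ^ 2 + K₂) := by
  have hN : ∀ t, 0 < ∑ b, Real.exp (ψ t b) := fun t =>
    Finset.sum_pos (fun _ _ => Real.exp_pos _) Finset.univ_nonempty
  have hmem : ∀ t, π t ∈ stdSimplex ℝ A := fun t => by
    refine ⟨fun a => ?_, ?_⟩
    · rw [hπ]
      exact (div_pos (Real.exp_pos _) (hN t)).le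
    · simp only [hπ]
      rw [← Finset.sum_div, div_self (hN t).ne']
  have dπ : ∀ a, ContDiff ℝ 2 fun t => π t a := fun a => by
    simp only [hπ]
    exact (dψ a).exp.div (ContDiff.sum fun b _ => (dψ b).exp) fun t => (hN t).ne'
  have hψ := fun a t => (dψ a).hasDerivAt_deriv_two t
  set h : A → ℝ → ℝ := fun a t => deriv (fun t => ψ t a) t with hh
  set m : ℝ → ℝ := fun t => ∑ b, π t b * h b t with hm
  have hπ' : ∀ a t, HasDerivAt (fun t => π t a) (π t a * (h a t - m t)) t := by
    intro a t
    have hexp := fun b => (hψ b t).1.exp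
    have hdiv := (hexp a).div (HasDerivAt.fun_sum fun b _ => hexp b) (hN t).ne'
    simp only [hπ]
    convert! hdiv using 1
    have h1 : m t = (∑ b, Real.exp (ψ t b) * h b t) / ∑ b, Real.exp (ψ t b) := by
      rw [hm, Finset.sum_div]
      exact Finset.sum_congr rfl fun b _ => by rw [hπ]; ring
    have h2 := (hN t).ne'
    rw [h1]
    field_simp
    ring
  have hderiv : ∀ a, deriv (fun t => π t a) = fun t => π t a * (h a t - m t) := fun a =>
    funext fun t => (hπ' a t).deriv
  have hh' : ∀ a t, HasDerivAt (h a) (deriv (deriv fun t => ψ t a) t) t := fun a t => (hψ a t).2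
  obtain ⟨m', hm'⟩ : ∃ m', HasDerivAt m m' t :=
    ⟨_, HasDerivAt.fun_sum fun b _ => (hπ' b t).mul (hh' b t)⟩
  have hsum := sum_deriv_eq_zero (fun t => (hmem t).2) dπ t
  have hmK : |m t| ≤ K₁ := abs_sum_le_of_mem_stdSimplex (hmem t) h₁
  constructor
  · refine (sum_abs_le_two_mul (y := fun a => π t a * h a t) (k := π t) (c := m t) (hmem t).1
      (fun a => ?_) hsum.1).trans ?_
    · rw [hderiv]
      ring
    · exact mul_le_mul_of_nonneg_left (sum_abs_mul_le (hmem t) h₁) zero_le_two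
  · refine (sum_abs_le_two_mul
      (y := fun a => π t a * ((h a t - m t) ^ 2 + deriv (deriv fun t => ψ t a) t))
      (k := π t) (c := m') (hmem t).1 (fun a => ?_) hsum.2).trans ?_
    · rw [hderiv]
      have := ((hπ' a t).mul ((hh' a t).sub hm')).deriv
      refine Eq.trans this ?_
      simp only [Pi.sub_apply]
      ring
    · refine mul_le_mul_of_nonneg_left (sum_abs_mul_le (hmem t) fun a => ?_) zero_le_two
      refine (abs_add_le _ _).trans (add_le_add ?_ (h₂ a))
      rw [abs_pow]
      have h1 : |h a t - m t| ≤ 2 * K₁ := (abs_sub _ _).trans (by linarith [h₁ a])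
      calc |h a t - m t| ^ 2 ≤ (2 * K₁) ^ 2 := by gcongr
        _ = 4 * K₁ ^ 2 := by ring

/-- If `z` deviates from its `p`-mean by at most `1 / 2`, the weights `1 / (m - z a)` of the
rational tilt are at most `2` and their `p`-second moment is at least `1`. -/
theorem tilt_weight_bounds {p z : A → ℝ} {m v : ℝ} (hp : p ∈ stdSimplex ℝ A)
    (hm : IsTiltShift p z m) (hv : ∑ a, p a * z a = v) (hz : ∀ a, |z a - v| ≤ 1 / 2) :
    (∀ a, 1 / (m - z a) ≤ 2) ∧ 1 ≤ ∑ a, p a / (m - z a) * (1 / (m - z a)) := by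
  -- Jensen: `1 = ∑ p / (m - z) ≥ ∑ p (2 - (m - z)) = 2 - (m - v)`.
  have h1 : 1 ≤ m - v := by
    have h2 : ∑ a, p a * (2 - (m - z a)) ≤ ∑ a, p a / (m - z a) := Finset.sum_le_sum fun a _ => by
      have h3 : 0 < m - z a := sub_pos.2 (hm.1 a)
      rw [div_eq_mul_one_div]
      refine mul_le_mul_of_nonneg_left ?_ (hp.1 a)
      rw [le_div_iff₀ h3]
      nlinarith [sq_nonneg (m - z a - 1)]
    have h3 : ∑ a, p a * (2 - (m - z a)) = 2 - (m - v) := by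
      have : ∀ a, p a * (2 - (m - z a)) = p a * (2 - m) + p a * z a := fun a => by ring
      simp only [this, Finset.sum_add_distrib, ← Finset.sum_mul, hp.2, hv]
      ring
    rw [h3, hm.2] at h2
    linarith
  constructor
  · intro a
    have := abs_le.1 (hz a)
    rw [div_le_iff₀ (sub_pos.2 (hm.1 a))]
    linarith
  · have h2 : ∑ a, (2 * (p a / (m - z a)) - p a) ≤ ∑ a, p a / (m - z a) * (1 / (m - z a)) :=
      Finset.sum_le_sum fun a _ => by
        have h3 : p a / (m - z a) * (1 / (m - z a)) - (2 * (p a / (m - z a)) - p a) =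
            p a * (1 / (m - z a) - 1) ^ 2 := by ring
        have h4 := mul_nonneg (hp.1 a) (sq_nonneg (1 / (m - z a) - 1))
        linarith
    rw [Finset.sum_sub_distrib, ← Finset.mul_sum, hm.2, hp.2] at h2
    linarith

/-- Derivative bounds for the rational tilt `π = p / (m - z)` along a path, where `p' = p g`.  With
`w = 1 / (m - z)` one has `π' = π (g - w (m' - z'))` and
`π'' = π ((g - w (m' - z'))² + g' + w² (m' - z')² - w (m'' - z''))`.  Neither `m'` in the first nor
`m''` in the second formula has to be bounded separately, by `sum_abs_le_two_mul`. -/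
theorem sum_abs_deriv_tilt_one_le [Nonempty A] {p z : ℝ → A → ℝ} {g : ℝ → A → ℝ} {g' : A → ℝ}
    {k K₂ t : ℝ}
    (hp0 : ∀ t a, 0 < p t a) (hp1 : ∀ t, ∑ a, p t a = 1)
    (dp : ∀ a, ContDiff ℝ 2 fun t => p t a) (dz : ∀ a, ContDiff ℝ 2 fun t => z t a)
    (hp' : ∀ t a, HasDerivAt (fun t => p t a) (p t a * g t a) t)
    (hg' : ∀ a, HasDerivAt (fun t => g t a) (g' a) t)
    (hg : ∀ a, |g t a| ≤ 2) (hg2 : ∀ a, |g' a| ≤ 2)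
    (hz : ∀ a, |z t a - ∑ b, p t b * z t b| ≤ 1 / 2) (hk : 0 ≤ k)
    (h₁ : ∀ a, |deriv (fun t => z t a) t| ≤ k)
    (h₂ : ∀ a, |deriv (deriv fun t => z t a) t| ≤ K₂) :
    ∑ a, |deriv (fun t => tilt .one (p t) (z t) a) t| ≤ 4 * (1 + k) ∧
      ∑ a, |deriv (deriv fun t => tilt .one (p t) (z t) a) t| ≤ 108 * (1 + k) ^ 2 + 4 * K₂ := by
  set π : ℝ → A → ℝ := fun t => tilt .one (p t) (z t) with hπ
  set m : ℝ → ℝ := fun t => tiltShift (p t) (z t) with hm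
  have hpm : ∀ t, p t ∈ stdSimplex ℝ A := fun t => ⟨fun a => (hp0 t a).le, hp1 t⟩
  have hmem : ∀ t, π t ∈ stdSimplex ℝ A := fun t => tilt_mem_stdSimplex .one (hp0 t) (hp1 t) (z t)
  have hshift : ∀ t, IsTiltShift (p t) (z t) (m t) := fun t =>
    isTiltShift_tiltShift (hp0 t) (hp1 t) (z t)
  have dm : ContDiff ℝ 2 m := contDiff_iff_contDiffAt.2 fun t =>
    contDiffAt_tiltShift two_ne_zero (hp0 t) (hp1 t) (fun a => (dp a).contDiffAt)
      fun a => (dz a).contDiffAt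
  have dπ : ∀ a, ContDiff ℝ 2 fun t => π t a := fun a => contDiff_iff_contDiffAt.2 fun t =>
    contDiffAt_tilt two_ne_zero .one (hp0 t) (hp1 t) (fun a => (dp a).contDiffAt)
      (fun a => (dz a).contDiffAt) a
  set w : ℝ → A → ℝ := fun t a => 1 / (m t - z t a) with hw
  have hwpos : ∀ t a, 0 < w t a := fun t a => one_div_pos.2 (sub_pos.2 ((hshift t).1 a))
  have hπw : ∀ t a, π t a = p t a * w t a := fun t a => div_eq_mul_one_div _ _
  obtain ⟨hw2, hpw⟩ := tilt_weight_bounds (hpm t) (hshift t) rfl hz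
  have hm' := dm.hasDerivAt_deriv_two
  have hz' := fun a t => (dz a).hasDerivAt_deriv_two t
  set e : ℝ → A → ℝ := fun t a => deriv m t - deriv (fun t => z t a) t with he
  have hw' : ∀ t a, HasDerivAt (fun t => w t a) (-(w t a) ^ 2 * e t a) t := by
    intro t a
    have h1 : HasDerivAt (fun t => m t - z t a) (e t a) t := (hm' t).1.sub (hz' a t).1
    have h2 := h1.inv (sub_pos.2 ((hshift t).1 a)).ne'
    simp only [hw, one_div]
    convert! h2 using 1
    rw [div_eq_mul_inv, ← inv_pow]
    ring
  have hπ' : ∀ a t, HasDerivAt (fun t => π t a) (π t a * (g t a - w t a * e t a)) t := by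
    intro a t
    have h1 := (hp' t a).mul (hw' t a)
    simp only [hπw]
    convert! h1 using 1
    ring
  have hderiv : ∀ a, deriv (fun t => π t a) = fun t => π t a * (g t a - w t a * e t a) := fun a =>
    funext fun t => (hπ' a t).deriv
  have he' : ∀ a, HasDerivAt (fun t => e t a)
      (deriv (deriv m) t - deriv (deriv fun t => z t a) t) t := fun a =>
    (hm' t).2.sub (hz' a t).2
  have hsum := sum_deriv_eq_zero (fun t => (hmem t).2) dπ t
  have hwabs : ∀ a, |w t a| ≤ 2 := fun a => by
    rw [abs_of_pos (hwpos t a)]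
    exact hw2 a
  have hπw0 : ∀ a, 0 ≤ π t a * w t a := fun a => mul_nonneg ((hmem t).1 a) (hwpos t a).le
  have hW : 1 ≤ ∑ a, π t a * w t a := hpw
  -- The normalization `∑ π' = 0` determines `m'`.
  have hmK : |deriv m t| ≤ 2 + k := by
    have h1 : (∑ a, π t a * w t a) * deriv m t =
        ∑ a, π t a * g t a + ∑ a, (π t a * w t a) * deriv (fun t => z t a) t := by
      have h2 := hsum.1
      have h3 : ∀ a, deriv (fun t => π t a) t = (π t a * g t a +
          (π t a * w t a) * deriv (fun t => z t a) t) - π t a * w t a * deriv m t := fun a => by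
        rw [hderiv]
        simp only [he]
        ring
      simp only [h3, Finset.sum_sub_distrib, Finset.sum_add_distrib, ← Finset.sum_mul] at h2
      linarith
    have h2 : |∑ a, (π t a * w t a) * deriv (fun t => z t a) t| ≤ (∑ a, π t a * w t a) * k :=
      abs_sum_mul_le_of_sum_abs_le
        (le_of_eq (Finset.sum_congr rfl fun a _ => abs_of_nonneg (hπw0 a))) hk h₁
    have h3 : |∑ a, π t a * g t a| ≤ 2 := abs_sum_le_of_mem_stdSimplex (hmem t) hg
    have h4 : (∑ a, π t a * w t a) * |deriv m t| ≤ 2 + (∑ a, π t a * w t a) * k := by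
      rw [← abs_of_nonneg (zero_le_one.trans hW), ← abs_mul, h1,
        abs_of_nonneg (zero_le_one.trans hW)]
      exact (abs_add_le _ _).trans (add_le_add h3 h2)
    nlinarith [abs_nonneg (deriv m t)]
  have heK : ∀ a, |e t a| ≤ 2 * (1 + k) := fun a =>
    (abs_sub _ _).trans (by linarith [h₁ a])
  have hweK : ∀ a, |w t a * e t a| ≤ 4 * (1 + k) := fun a => by
    rw [abs_mul]
    calc |w t a| * |e t a| ≤ 2 * (2 * (1 + k)) :=
          mul_le_mul (hwabs a) (heK a) (abs_nonneg _) zero_le_two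
      _ = 4 * (1 + k) := by ring
  constructor
  · refine (sum_abs_le_two_mul
      (y := fun a => π t a * (g t a + w t a * deriv (fun t => z t a) t))
      (k := fun a => π t a * w t a) (c := deriv m t) hπw0 (fun a => ?_) hsum.1).trans ?_
    · rw [hderiv]
      simp only [he]
      ring
    · have h3 : ∑ a, |π t a * (g t a + w t a * deriv (fun t => z t a) t)| ≤ 2 + 2 * k :=
        sum_abs_mul_le (hmem t) fun a => by
          refine (abs_add_le _ _).trans (add_le_add (hg a) ?_)
          rw [abs_mul]
          exact mul_le_mul (hwabs a) (h₁ a) (abs_nonneg _) zero_le_two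
      linarith
  · refine (sum_abs_le_two_mul
      (y := fun a => π t a * ((g t a - w t a * e t a) ^ 2 + g' a + (w t a * e t a) ^ 2 +
        w t a * deriv (deriv fun t => z t a) t))
      (k := fun a => π t a * w t a) (c := deriv (deriv m) t) hπw0 (fun a => ?_) hsum.2).trans ?_
    · rw [hderiv]
      have h3 := ((hπ' a t).mul ((hg' a).sub ((hw' t a).mul (he' a)))).deriv
      refine Eq.trans h3 ?_
      simp only [Pi.sub_apply, Pi.mul_apply]
      ring
    · have h3 : ∑ a, |π t a * ((g t a - w t a * e t a) ^ 2 + g' a + (w t a * e t a) ^ 2 +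
          w t a * deriv (deriv fun t => z t a) t)| ≤
          (6 * (1 + k)) ^ 2 + 2 + (4 * (1 + k)) ^ 2 + 2 * K₂ :=
        sum_abs_mul_le (hmem t) fun a => by
          refine (abs_add_le _ _).trans (add_le_add ((abs_add_le _ _).trans (add_le_add
            ((abs_add_le _ _).trans (add_le_add ?_ (hg2 a))) ?_)) ?_)
          · rw [abs_pow]
            have h4 : |g t a - w t a * e t a| ≤ 6 * (1 + k) :=
              (abs_sub _ _).trans (by linarith [hg a, hweK a])
            gcongr
          · rw [abs_pow]
            have := hweK a
            gcongr
          · rw [abs_mul]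
            exact mul_le_mul (hwabs a) (h₂ a) (abs_nonneg _) zero_le_two
      nlinarith

end PolicyPath

/-! ### The adapted reward along a line -/

section LineBounds

variable {S A : Type*}

theorem hasDerivAt_add_smul_apply (φ u : Param S A) (c : S × A) (t : ℝ) :
    HasDerivAt (fun t : ℝ => (φ + t • u) c) (u c) t := by
  simpa using! ((hasDerivAt_id t).mul_const (u c)).const_add (φ c)

variable [Fintype A]

theorem hasDerivAt_softmaxPolicy_line [Nonempty A] (φ u : Param S A) (s : S) (a : A) (t : ℝ) :
    HasDerivAt (fun t : ℝ => softmaxPolicy (φ + t • u) s a)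
      (softmaxPolicy (φ + t • u) s a *
        (u (s, a) - ∑ b, softmaxPolicy (φ + t • u) s b * u (s, b))) t := by
  have h1 := fun a => hasDerivAt_add_smul_apply φ u (s, a) t
  have hN : ∑ b, Real.exp ((φ + t • u) (s, b)) ≠ 0 :=
    (Finset.sum_pos (fun _ _ => Real.exp_pos _) Finset.univ_nonempty).ne'
  have hdiv := (h1 a).exp.div (HasDerivAt.fun_sum fun b _ => (h1 b).exp) hN
  convert! hdiv using 1
  have h2 : ∑ b, softmaxPolicy (φ + t • u) s b * u (s, b) =
      (∑ b, Real.exp ((φ + t • u) (s, b)) * u (s, b)) / ∑ b, Real.exp ((φ + t • u) (s, b)) := by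
    rw [Finset.sum_div]
    exact Finset.sum_congr rfl fun b _ => by rw [softmaxPolicy]; ring
  rw [h2, softmaxPolicy]
  field_simp

variable [Fintype S]

theorem contDiff_add_smul (φ u : Param S A) : ContDiff ℝ 2 fun t : ℝ => φ + t • u := by
  fun_prop

variable [Nonempty A]

theorem sum_abs_deriv_softmaxPolicy_le {φ u : Param S A} (hu : ∀ c, |u c| ≤ 1) (s : S) (t : ℝ) :
    ∑ a, |deriv (fun t : ℝ => softmaxPolicy (φ + t • u) s a) t| ≤ 2 ∧
      ∑ a, |deriv (deriv fun t : ℝ => softmaxPolicy (φ + t • u) s a) t| ≤ 8 := by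
  have h1 := fun a t => hasDerivAt_add_smul_apply φ u (s, a) t
  have h2 : ∀ a, deriv (fun t : ℝ => (φ + t • u) (s, a)) = fun _ => u (s, a) := fun a =>
    funext fun t => (h1 a t).deriv
  have h := sum_abs_deriv_exp_le (π := fun t : ℝ => softmaxPolicy (φ + t • u) s)
    (ψ := fun t a => (φ + t • u) (s, a)) (K₁ := 1) (K₂ := 0) (t := t) (fun _ _ => rfl)
    (fun a => (contDiff_piLp 2).1 (contDiff_add_smul φ u) (s, a)) (fun a => by rw [h2]; exact hu _)
    (fun a => by rw [h2]; simp)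
  norm_num at h
  exact h

variable [DecidableEq S]

/-- Bound on `∑ a, |π'(a|s)|` for the adapted policy along a line with unit direction. -/
noncomputable def AlgIndex.policySlope (i : AlgIndex) (γ : ℝ) : ℝ :=
  match i with
  | .one => 4 / (1 - γ)
  | .two => 2 / (1 - γ)

/-- Bound on `∑ a, |π''(a|s)|` for the adapted policy along a line with unit direction. -/
noncomputable def AlgIndex.policyCurvature (i : AlgIndex) (γ r lam : ℝ) : ℝ :=
  match i with
  | .one => 108 / (1 - γ) ^ 2 + 32 * r / (lam * (1 - γ) ^ 3)
  | .two => 8 / (1 - γ) ^ 2 + 16 * r / (lam * (1 - γ) ^ 3)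

variable {γ r lam Amax : ℝ} {T R : S → A → S → ℝ}

theorem contDiff_tiltPolicy_line (i : AlgIndex) (hγ₀ : 0 ≤ γ) (hγ₁ : γ < 1)
    (hT : ∀ s a, T s a ∈ stdSimplex ℝ S) (φ u : Param S A) (s : S) (a : A) :
    ContDiff ℝ 2 fun t : ℝ => tiltPolicy i γ lam T R (φ + t • u) s a :=
  contDiff_iff_contDiffAt.2 fun _ => contDiffAt_tiltPolicy (T := fun _ => T) (R := fun _ => R)
    two_ne_zero i hγ₀ hγ₁ hT (fun _ _ _ => contDiffAt_const) (fun _ _ _ => contDiffAt_const)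
    (contDiff_add_smul φ u).contDiffAt s a

/-- The derivative bounds for the adapted policy.  The softmax bounds `c₁ = 2`, `c₂ = 8` give
`|Q'| / lam ≤ γ / (1 - γ)` and `|Q''| / lam ≤ 8 r / (lam (1 - γ)³)`, which are the inputs of the
bounds for the two tilts. -/
theorem sum_abs_deriv_tiltPolicy_le (i : AlgIndex) (hγ₀ : 0 ≤ γ) (hγ₁ : γ < 1)
    (hr : 0 ≤ r) (hA : 0 < Amax) (hlam : 2 * Amax ≤ lam)
    (hT : ∀ s a, T s a ∈ stdSimplex ℝ S) (hR : ∀ s a s', |R s a s'| ≤ r)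
    (hadv : ∀ (θ : Param S A) s a,
      |bellmanQ γ T R (softmaxPolicy θ) s a - bellmanValue γ T R (softmaxPolicy θ) s| ≤ Amax)
    {φ u : Param S A} (hu : ∀ c, |u c| ≤ 1) (s : S) (t : ℝ) :
    ∑ a, |deriv (fun t : ℝ => tiltPolicy i γ lam T R (φ + t • u) s a) t| ≤ i.policySlope γ ∧
      ∑ a, |deriv (deriv fun t : ℝ => tiltPolicy i γ lam T R (φ + t • u) s a) t| ≤
        i.policyCurvature γ r lam := by
  have hd : 0 < 1 - γ := by linarith
  have hlam0 : 0 < lam := by linarith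
  set p : ℝ → S → A → ℝ := fun t => softmaxPolicy (φ + t • u) with hp
  have hpm : ∀ t s, p t s ∈ stdSimplex ℝ A := fun t => softmaxPolicy_mem_stdSimplex _
  have dp : ∀ s a, ContDiff ℝ 2 fun t => p t s a := fun s a =>
    contDiff_iff_contDiffAt.2 fun t =>
      contDiffAt_softmaxPolicy (contDiff_add_smul φ u).contDiffAt s a
  set q : ℝ → S → A → ℝ := fun t => bellmanQ γ T R (p t) with hq
  have dq : ∀ s a, ContDiff ℝ 2 fun t => q t s a := contDiff_bellmanQ_path hγ₀ hγ₁ hT hpm dp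
  have hq1 : ∀ a, |deriv (fun t => q t s a) t| ≤ γ * (2 * Amax / (1 - γ)) := fun a => by
    rw [(deriv_bellmanQ_path hγ₀ hγ₁ hT hpm dp s a).1, abs_mul, abs_of_nonneg hγ₀]
    refine mul_le_mul_of_nonneg_left (abs_sum_le_of_mem_stdSimplex (hT s a) fun s' => ?_) hγ₀
    exact abs_deriv_bellmanValue_le_of_advantage hγ₀ hγ₁ hT hpm dp hA.le (hadv _)
      (fun s => (sum_abs_deriv_softmaxPolicy_le hu s t).1) s'
  have hq2 : ∀ a, |deriv (deriv fun t => q t s a) t| ≤ γ * ((8 * (r / (1 - γ)) +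
      2 * (2 * (γ * (2 * (r / (1 - γ)) / (1 - γ))))) / (1 - γ)) := fun a => by
    rw [(deriv_bellmanQ_path hγ₀ hγ₁ hT hpm dp s a).2, abs_mul, abs_of_nonneg hγ₀]
    refine mul_le_mul_of_nonneg_left (abs_sum_le_of_mem_stdSimplex (hT s a) fun s' => ?_) hγ₀
    exact abs_deriv_deriv_bellmanValue_le hγ₀ hγ₁ hT hR hr hpm dp zero_le_two
      (fun s => (sum_abs_deriv_softmaxPolicy_le hu s t).1)
      (fun s => (sum_abs_deriv_softmaxPolicy_le hu s t).2) s'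
  set z : ℝ → A → ℝ := fun t a => q t s a / lam with hz
  have dz : ∀ a, ContDiff ℝ 2 fun t => z t a := fun a => (dq s a).div_const lam
  have hz1' : ∀ a, deriv (fun t => z t a) = fun t => deriv (fun t => q t s a) t / lam := fun a =>
    funext fun t => deriv_div_const lam
  have hz2' : ∀ a, deriv (deriv fun t => z t a) t = deriv (deriv fun t => q t s a) t / lam :=
    fun a => by
      rw [hz1']
      exact deriv_div_const lam
  have hz1 : ∀ a, |deriv (fun t => z t a) t| ≤ γ / (1 - γ) := fun a => by
    rw [hz1']
    simp only [abs_div, abs_of_pos hlam0]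
    rw [div_le_iff₀ hlam0]
    refine (hq1 a).trans ?_
    have h1 : γ * (2 * Amax / (1 - γ)) = γ / (1 - γ) * (2 * Amax) := by ring
    rw [h1]
    exact mul_le_mul_of_nonneg_left hlam (by positivity)
  have hz2 : ∀ a, |deriv (deriv fun t => z t a) t| ≤ 8 * r / (lam * (1 - γ) ^ 3) := fun a => by
    rw [hz2', abs_div, abs_of_pos hlam0]
    have h1 : γ * ((8 * (r / (1 - γ)) + 2 * (2 * (γ * (2 * (r / (1 - γ)) / (1 - γ))))) / (1 - γ)) =
        γ * (8 * r / (1 - γ) ^ 3) := by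
      field_simp
      ring
    have h2 : γ * (8 * r / (1 - γ) ^ 3) ≤ 8 * r / (1 - γ) ^ 3 :=
      mul_le_of_le_one_left (by positivity) hγ₁.le
    have h3 : 8 * r / (lam * (1 - γ) ^ 3) = 8 * r / (1 - γ) ^ 3 / lam := by
      field_simp
    rw [h3]
    have := hq2 a
    gcongr
    linarith
  have hk : 1 + γ / (1 - γ) = 1 / (1 - γ) := by
    field_simp
    ring
  have hk0 : 0 ≤ γ / (1 - γ) := by positivity
  cases i with
  | one =>
    have hmean : ∑ b, p t s b * z t b = bellmanValue γ T R (p t) s / lam := by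
      rw [bellmanValue_eq hγ₀ hγ₁ hT R (hpm t) s, Finset.sum_div]
      exact Finset.sum_congr rfl fun b _ => by rw [hz, hq]; ring
    set g : ℝ → A → ℝ := fun t a => u (s, a) - ∑ b, p t s b * u (s, b) with hg
    have hmu : |∑ b, p t s b * u (s, b)| ≤ 1 :=
      abs_sum_le_of_mem_stdSimplex (hpm t s) fun b => hu _
    have hp1 := fun b => ((dp s b).hasDerivAt_deriv_two t).1
    have h := sum_abs_deriv_tilt_one_le (p := fun t => p t s) (z := z) (g := g)
      (g' := fun a => 0 - ∑ b, deriv (fun t => p t s b) t * u (s, b)) (k := γ / (1 - γ))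
      (K₂ := 8 * r / (lam * (1 - γ) ^ 3)) (t := t)
      (fun t => softmaxPolicy_pos _ s) (fun t => sum_softmaxPolicy _ s) (dp s) dz
      (fun t a => hasDerivAt_softmaxPolicy_line φ u s a t)
      (fun a => (hasDerivAt_const t (u (s, a))).sub
        (HasDerivAt.fun_sum fun b _ => (hp1 b).mul_const (u (s, b))))
      (fun a => (abs_sub _ _).trans (by linarith [hu (s, a)]))
      (fun a => by
        rw [zero_sub, abs_neg]
        have := abs_sum_mul_le_of_sum_abs_le (sum_abs_deriv_softmaxPolicy_le (φ := φ) hu s t).1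
          zero_le_one fun b => hu (s, b)
        linarith)
      (fun a => by
        rw [hmean, hz]
        simp only
        rw [← sub_div, abs_div, abs_of_pos hlam0, div_le_iff₀ hlam0]
        exact (hadv _ s a).trans (by linarith)) hk0 hz1 hz2
    rw [hk] at h
    refine ⟨h.1.trans_eq ?_, h.2.trans_eq ?_⟩
    · simp only [AlgIndex.policySlope]
      ring
    · simp only [AlgIndex.policyCurvature]
      generalize 1 - γ = d
      ring
  | two =>
    -- The exponential tilt is the softmax policy of the preferences `φ + t u + Q / lam`.
    have h1 := fun a t => hasDerivAt_add_smul_apply φ u (s, a) t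
    have hψ : ∀ a, deriv (fun t : ℝ => (φ + t • u) (s, a) + z t a) =
        fun t => u (s, a) + deriv (fun t => z t a) t := fun a =>
      funext fun t => ((h1 a t).add ((dz a).hasDerivAt_deriv_two t).1).deriv
    have hψ2 : ∀ a, deriv (deriv fun t : ℝ => (φ + t • u) (s, a) + z t a) t =
        deriv (deriv fun t => z t a) t := fun a => by
      rw [hψ]
      exact (((dz a).hasDerivAt_deriv_two t).2.const_add _).deriv
    have h := sum_abs_deriv_exp_le
      (π := fun t : ℝ => tiltPolicy .two γ lam T R (φ + t • u) s)
      (ψ := fun t a => (φ + t • u) (s, a) + z t a) (K₁ := 1 / (1 - γ))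
      (K₂ := 8 * r / (lam * (1 - γ) ^ 3)) (t := t)
      (fun t a => by
        have hN : ∑ b, Real.exp ((φ + t • u) (s, b)) ≠ 0 :=
          (Finset.sum_pos (fun _ _ => Real.exp_pos _) Finset.univ_nonempty).ne'
        simp only [tiltPolicy, tilt, softmaxPolicy, div_mul_eq_mul_div, ← Real.exp_add]
        rw [← Finset.sum_div, div_div_div_cancel_right₀ hN])
      (fun a => ((contDiff_piLp 2).1 (contDiff_add_smul φ u) (s, a)).add (dz a))
      (fun a => by
        rw [hψ, ← hk]
        exact (abs_add_le _ _).trans (add_le_add (hu _) (hz1 a)))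
      (fun a => by
        rw [hψ2]
        exact hz2 a)
    refine ⟨h.1.trans_eq ?_, h.2.trans_eq ?_⟩
    · simp only [AlgIndex.policySlope]
      ring
    · simp only [AlgIndex.policyCurvature]
      generalize 1 - γ = d
      ring

/-- The smoothness constant of the adapted reward that results from the derivative bounds on the
adapted policy. -/
noncomputable def AlgIndex.smoothness (i : AlgIndex) (γ r lam : ℝ) : ℝ :=
  (i.policyCurvature γ r lam * (r / (1 - γ)) +
    2 * (i.policySlope γ * (γ * (i.policySlope γ * (r / (1 - γ)) / (1 - γ))))) / (1 - γ)

theorem AlgIndex.policySlope_pos (i : AlgIndex) (hγ₁ : γ < 1) : 0 < i.policySlope γ := by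
  have hd : 0 < 1 - γ := by linarith
  cases i <;> simp only [AlgIndex.policySlope] <;> positivity

theorem AlgIndex.policySlope_mul_div (i : AlgIndex) (γ Amax : ℝ) :
    i.policySlope γ * Amax / (1 - γ) = i.constG γ Amax := by
  cases i <;> simp only [AlgIndex.policySlope, AlgIndex.constG] <;> generalize 1 - γ = d <;> ring

/-- First and second derivative bounds for the adapted reward along a line.  The advantage bound,
assumed for softmax policies, applies to the adapted policy because that is a softmax policy too. -/
theorem abs_deriv_rawReward_line_le (i : AlgIndex) (hγ₀ : 0 ≤ γ) (hγ₁ : γ < 1)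
    (hr : 0 ≤ r) (hA : 0 < Amax) (hlam : 2 * Amax ≤ lam) {ρ : S → ℝ} (hρ : ρ ∈ stdSimplex ℝ S)
    (hT : ∀ s a, T s a ∈ stdSimplex ℝ S) (hR : ∀ s a s', |R s a s'| ≤ r)
    (hadv : ∀ (θ : Param S A) s a,
      |bellmanQ γ T R (softmaxPolicy θ) s a - bellmanValue γ T R (softmaxPolicy θ) s| ≤ Amax)
    {φ u : Param S A} (hu : ∀ c, |u c| ≤ 1) (t : ℝ) :
    |deriv (fun t : ℝ => rawReward i γ lam ρ T R (φ + t • u)) t| ≤ i.constG γ Amax ∧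
      |deriv (deriv fun t : ℝ => rawReward i γ lam ρ T R (φ + t • u)) t| ≤
        i.smoothness γ r lam := by
  set π : ℝ → S → A → ℝ := fun t => tiltPolicy i γ lam T R (φ + t • u) with hπ
  have hm : ∀ t s, π t s ∈ stdSimplex ℝ A := fun t s => tiltPolicy_mem_stdSimplex i γ lam T R _ s
  have dπ : ∀ s a, ContDiff ℝ 2 fun t => π t s a :=
    contDiff_tiltPolicy_line i hγ₀ hγ₁ hT φ u
  have hV := fun s t =>
    (contDiff_bellmanValue_path (R := R) hγ₀ hγ₁ hT hm dπ s).hasDerivAt_deriv_two t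
  have hb := fun s => sum_abs_deriv_tiltPolicy_le i hγ₀ hγ₁ hr hA hlam hT hR hadv (φ := φ) hu s t
  have h1 : deriv (fun t : ℝ => rawReward i γ lam ρ T R (φ + t • u)) =
      fun t => ∑ s, ρ s * deriv (fun t => bellmanValue γ T R (π t) s) t :=
    funext fun t => (HasDerivAt.fun_sum fun s _ => (hV s t).1.const_mul (ρ s)).deriv
  have h2 : deriv (deriv fun t : ℝ => rawReward i γ lam ρ T R (φ + t • u)) t =
      ∑ s, ρ s * deriv (deriv fun t => bellmanValue γ T R (π t) s) t := by
    rw [h1]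
    exact (HasDerivAt.fun_sum fun s _ => (hV s t).2.const_mul (ρ s)).deriv
  constructor
  · rw [h1, ← i.policySlope_mul_div]
    obtain ⟨θ, hθ⟩ := exists_softmaxPolicy_eq (tiltPolicy_pos i γ lam T R (φ + t • u))
      (sum_tiltPolicy i γ lam T R (φ + t • u))
    have hadv' := hadv θ
    rw [hθ] at hadv'
    exact abs_sum_le_of_mem_stdSimplex hρ
      (abs_deriv_bellmanValue_le_of_advantage hγ₀ hγ₁ hT hm dπ hA.le hadv' fun s => (hb s).1)
  · rw [h2]
    exact abs_sum_le_of_mem_stdSimplex hρ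
      (abs_deriv_deriv_bellmanValue_le hγ₀ hγ₁ hT hR hr hm dπ (i.policySlope_pos hγ₁).le
        (fun s => (hb s).1) fun s => (hb s).2)

end LineBounds

/-! ### Quadratic lower bounds and stochastic gradient ascent -/

section Lines

theorem le_of_abs_deriv_deriv_le {j : ℝ → ℝ} (hj : ContDiff ℝ 2 j) {L : ℝ}
    (hL : ∀ t, |deriv (deriv j) t| ≤ L) {η : ℝ} (hη : 0 ≤ η) :
    j 0 + η * deriv j 0 - L / 2 * η ^ 2 ≤ j η := by
  have h := hj.hasDerivAt_deriv_two
  have h1 : ∀ t, HasDerivAt (fun t => deriv j t + L * t) (deriv (deriv j) t + L) t := fun t => by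
    simpa using! (h t).2.add ((hasDerivAt_id t).const_mul L)
  have hmono : Monotone fun t => deriv j t + L * t :=
    monotone_of_deriv_nonneg (fun t => (h1 t).differentiableAt) fun t => by
      rw [(h1 t).deriv]
      linarith [(abs_le.1 (hL t)).1]
  have h2 : ∀ t, HasDerivAt (fun t => j t + L / 2 * t ^ 2 - t * deriv j 0)
      (deriv j t + L * t - deriv j 0) t := fun t => by
    have h3 := ((h t).1.add ((hasDerivAt_pow 2 t).const_mul (L / 2))).sub
      ((hasDerivAt_id t).mul_const (deriv j 0))
    convert! h3 using 1
    simp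
    ring
  have hmono2 : MonotoneOn (fun t => j t + L / 2 * t ^ 2 - t * deriv j 0) (Set.Ici 0) :=
    monotoneOn_of_deriv_nonneg (convex_Ici 0)
      (fun t _ => (h2 t).continuousAt.continuousWithinAt)
      (fun t _ => (h2 t).differentiableAt.differentiableWithinAt) fun t ht => by
      rw [interior_Ici] at ht
      rw [(h2 t).deriv]
      have := hmono (le_of_lt ht)
      simp only [mul_zero, add_zero] at this
      linarith
  have h4 := hmono2 (Set.mem_Ici.2 le_rfl) (Set.mem_Ici.2 hη) hη
  simp only at h4
  linarith

variable {E : Type*} [NormedAddCommGroup E] [NormedSpace ℝ E] {f : E → ℝ}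

theorem deriv_comp_add_smul (hf : Differentiable ℝ f) (x u : E) (t : ℝ) :
    deriv (fun t : ℝ => f (x + t • u)) t = fderiv ℝ f (x + t • u) u := by
  have h1 : HasDerivAt (fun t : ℝ => x + t • u) u t := by
    simpa using! ((hasDerivAt_id t).smul_const u).const_add x
  exact ((hf _).hasFDerivAt.comp_hasDerivAt t h1).deriv

theorem norm_fderiv_le_of_abs_deriv_le {G : ℝ} (hG : 0 ≤ G) (hf : Differentiable ℝ f)
    (h : ∀ x u : E, ‖u‖ = 1 → |deriv (fun t : ℝ => f (x + t • u)) 0| ≤ G) (x : E) :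
    ‖fderiv ℝ f x‖ ≤ G := by
  refine ContinuousLinearMap.opNorm_le_of_unit_norm hG fun u hu => ?_
  have := h x u hu
  rw [deriv_comp_add_smul hf] at this
  simpa using this

/-- Second-derivative bounds along unit-speed lines give a global quadratic lower bound. -/
theorem add_fderiv_sub_le_of_abs_deriv_deriv_le {L : ℝ} (hf : ContDiff ℝ 2 f)
    (h : ∀ x u : E, ‖u‖ = 1 → ∀ t, |deriv (deriv fun t : ℝ => f (x + t • u)) t| ≤ L) (x v : E) :
    f x + fderiv ℝ f x v - L / 2 * ‖v‖ ^ 2 ≤ f (x + v) := by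
  rcases eq_or_ne v 0 with rfl | hv
  · simp
  have hv' : ‖v‖ ≠ 0 := norm_ne_zero_iff.2 hv
  set u : E := ‖v‖⁻¹ • v with hu
  have hvu : ‖v‖ • u = v := by rw [hu, smul_smul, mul_inv_cancel₀ hv', one_smul]
  have hu1 : ‖u‖ = 1 := by rw [hu, norm_smul, norm_inv, norm_norm, inv_mul_cancel₀ hv']
  have h1 := le_of_abs_deriv_deriv_le (j := fun t : ℝ => f (x + t • u)) (by fun_prop) (h x u hu1)
    (norm_nonneg v)
  rw [deriv_comp_add_smul (hf.differentiable two_ne_zero), zero_smul, add_zero, hvu, ← smul_eq_mul,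
    ← map_smul, hvu] at h1
  exact h1

end Lines

section StochasticAscent

open scoped RealInnerProductSpace

variable {E Γ Ω : Type*} [NormedAddCommGroup E] [InnerProductSpace ℝ E] [FiniteDimensional ℝ E]
  [MeasurableSpace E] [BorelSpace E] [MeasurableSpace Γ] [MeasurableSpace Ω]

theorem measurable_gradient (F : E → ℝ) : Measurable (gradient F) :=
  (InnerProductSpace.toDual ℝ E).symm.continuous.measurable.comp (measurable_fderiv ℝ F)

/-- A stochastic gradient evaluated at an independent point has the same correlation with the
gradient as the gradient itself: Fubini for the joint law `law(X) ⊗ P`. -/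
theorem integral_inner_gradient_eq {F : E → ℝ} {g : Γ → E → E} {G : ℝ} {P : Measure Γ}
    [IsProbabilityMeasure P] {μ : Measure Ω} [IsProbabilityMeasure μ] {X : Ω → E} {τ : Ω → Γ}
    (hg : Measurable fun x : Γ × E => g x.1 x.2) (hgG : ∀ τ x, ‖g τ x‖ ≤ G)
    (hF : ∀ x, ∫ τ, g τ x ∂P = gradient F x) (hFG : ∀ x, ‖gradient F x‖ ≤ G)
    (hX : Measurable X) (hτ : Measurable τ) (hlaw : μ.map τ = P) (hind : IndepFun X τ μ) :
    ∫ ω, ⟪gradient F (X ω), g (τ ω) (X ω)⟫ ∂μ = ∫ ω, ‖gradient F (X ω)‖ ^ 2 ∂μ := by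
  have hmap := (indepFun_iff_map_prod_eq_prod_map_map hX.aemeasurable hτ.aemeasurable).1 hind
  rw [hlaw] at hmap
  have : IsProbabilityMeasure (μ.map X) := Measure.isProbabilityMeasure_map hX.aemeasurable
  set k : E × Γ → ℝ := fun y => ⟪gradient F y.1, g y.2 y.1⟫ with hk
  have hkm : Measurable k :=
    ((measurable_gradient F).comp measurable_fst).inner (hg.comp measurable_swap)
  have hkint : Integrable k ((μ.map X).prod P) := by
    refine Integrable.of_bound hkm.aestronglyMeasurable (G * G) (Filter.Eventually.of_forall ?_)
    intro y
    exact (norm_inner_le_norm _ _).trans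
      (mul_le_mul (hFG _) (hgG _ _) (norm_nonneg _) ((norm_nonneg _).trans (hFG 0)))
  have hgint : ∀ x, Integrable (fun τ => g τ x) P := fun x =>
    Integrable.of_bound (hg.comp (measurable_id.prodMk measurable_const)).aestronglyMeasurable G
      (Filter.Eventually.of_forall fun τ => hgG τ x)
  calc ∫ ω, ⟪gradient F (X ω), g (τ ω) (X ω)⟫ ∂μ
      = ∫ y, k y ∂(μ.map fun ω => (X ω, τ ω)) :=
        (integral_map (hX.prodMk hτ).aemeasurable hkm.aestronglyMeasurable).symm
    _ = ∫ x, ∫ τ, k (x, τ) ∂P ∂(μ.map X) := by rw [hmap, integral_prod k hkint]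
    _ = ∫ x, ‖gradient F x‖ ^ 2 ∂(μ.map X) := by
        refine integral_congr_ae (Filter.Eventually.of_forall fun x => ?_)
        simp only [hk]
        rw [integral_inner (hgint x), hF, real_inner_self_eq_norm_sq]
    _ = _ := integral_map hX.aemeasurable
        ((measurable_gradient F).norm.pow_const 2).aestronglyMeasurable

/-- Stochastic gradient ascent with a constant step size on a bounded function that is smooth in
the sense of a quadratic lower bound. -/
theorem sum_integral_norm_gradient_sq_le {F : E → ℝ} {g : Γ → E → E} {G L R α : ℝ} {P : Measure Γ}
    [IsProbabilityMeasure P] {μ : Measure Ω} [IsProbabilityMeasure μ] {X : ℕ → Ω → E}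
    {τ : ℕ → Ω → Γ} (hα : 0 < α) (hL : 0 ≤ L)
    (hg : Measurable fun x : Γ × E => g x.1 x.2) (hgG : ∀ τ x, ‖g τ x‖ ≤ G)
    (hF : ∀ x, ∫ τ, g τ x ∂P = gradient F x) (hFm : Measurable F) (hFR : ∀ x, |F x| ≤ R)
    (hFL : ∀ x v, F x + ⟪gradient F x, v⟫ - L / 2 * ‖v‖ ^ 2 ≤ F (x + v))
    (hX : ∀ t, Measurable (X t)) (hτ : ∀ t, Measurable (τ t)) (hlaw : ∀ t, μ.map (τ t) = P)
    (hind : ∀ t, IndepFun (X t) (τ t) μ)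
    (hstep : ∀ t ω, X (t + 1) ω = X t ω + α • g (τ t ω) (X t ω)) (T : ℕ) :
    (∀ t, Integrable (fun ω => ‖gradient F (X t ω)‖ ^ 2) μ) ∧
      ∑ t ∈ Finset.Icc 1 T, ∫ ω, ‖gradient F (X t ω)‖ ^ 2 ∂μ ≤
        2 * R / α + T * (L * α * G ^ 2 / 2) := by
  have hFG : ∀ x, ‖gradient F x‖ ≤ G := fun x => by
    rw [← hF]
    refine (norm_integral_le_of_norm_le_const (Filter.Eventually.of_forall fun τ => hgG τ x)).trans
      (le_of_eq ?_)
    simp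
  have hG : 0 ≤ G := (norm_nonneg _).trans (hFG 0)
  have hint : ∀ t, Integrable (fun ω => ‖gradient F (X t ω)‖ ^ 2) μ := fun t =>
    Integrable.of_bound
      (((measurable_gradient F).comp (hX t)).norm.pow_const 2).aestronglyMeasurable (G ^ 2)
      (Filter.Eventually.of_forall fun ω => by
        rw [norm_pow, norm_norm]
        exact pow_le_pow_left₀ (norm_nonneg _) (hFG _) 2)
  refine ⟨hint, ?_⟩
  have hFint : ∀ t, Integrable (fun ω => F (X t ω)) μ := fun t =>
    Integrable.of_bound (hFm.comp (hX t)).aestronglyMeasurable R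
      (Filter.Eventually.of_forall fun ω => hFR _)
  have hinner : ∀ t, Integrable (fun ω => ⟪gradient F (X t ω), g (τ t ω) (X t ω)⟫) μ := fun t =>
    Integrable.of_bound
      (((measurable_gradient F).comp (hX t)).inner
        (hg.comp ((hτ t).prodMk (hX t)))).aestronglyMeasurable (G * G)
      (Filter.Eventually.of_forall fun ω => (norm_inner_le_norm _ _).trans
        (mul_le_mul (hFG _) (hgG _ _) (norm_nonneg _) hG))
  have hdescent : ∀ t, ∫ ω, F (X t ω) ∂μ + α * ∫ ω, ‖gradient F (X t ω)‖ ^ 2 ∂μ -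
      L / 2 * (α * G) ^ 2 ≤ ∫ ω, F (X (t + 1) ω) ∂μ := by
    intro t
    rw [← integral_inner_gradient_eq hg hgG hF hFG (hX t) (hτ t) (hlaw t) (hind t),
      ← integral_const_mul, ← integral_add (hFint t) ((hinner t).const_mul α)]
    have h1 : L / 2 * (α * G) ^ 2 = ∫ _ω, L / 2 * (α * G) ^ 2 ∂μ := by simp
    have hadd : Integrable (fun ω => F (X t ω) +
        α * ⟪gradient F (X t ω), g (τ t ω) (X t ω)⟫) μ := (hFint t).add ((hinner t).const_mul α)
    rw [h1, ← integral_sub hadd (integrable_const _)]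
    refine integral_mono (hadd.sub (integrable_const _)) (hFint (t + 1)) fun ω => ?_
    have h2 := hFL (X t ω) (α • g (τ t ω) (X t ω))
    rw [inner_smul_right, norm_smul, Real.norm_of_nonneg hα.le, ← hstep] at h2
    have h3 : (α * ‖g (τ t ω) (X t ω)‖) ^ 2 ≤ (α * G) ^ 2 := by
      have := hgG (τ t ω) (X t ω)
      gcongr
    have h4 := mul_le_mul_of_nonneg_left h3 (div_nonneg hL zero_le_two)
    simp only
    linarith
  have htel : ∀ n : ℕ, α * ∑ t ∈ Finset.Icc 1 n, ∫ ω, ‖gradient F (X t ω)‖ ^ 2 ∂μ ≤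
      ∫ ω, F (X (n + 1) ω) ∂μ - ∫ ω, F (X 1 ω) ∂μ + n * (L / 2 * (α * G) ^ 2) := by
    intro n
    induction n with
    | zero => simp
    | succ n ih =>
      rw [Finset.sum_Icc_succ_top (by omega), mul_add]
      have := hdescent (n + 1)
      push_cast
      linarith
  have hFabs : ∀ t, |∫ ω, F (X t ω) ∂μ| ≤ R := fun t => by
    have := norm_integral_le_of_norm_le_const (μ := μ) (f := fun ω => F (X t ω)) (C := R)
      (Filter.Eventually.of_forall fun ω => hFR _)
    simpa using this
  have h1 := htel T
  have h2 := (abs_le.1 (hFabs (T + 1))).2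
  have h3 := (abs_le.1 (hFabs 1)).1
  have h4 : 2 * R / α + T * (L * α * G ^ 2 / 2) =
      (2 * R + T * (L / 2 * (α * G) ^ 2)) / α := by
    field_simp
  rw [h4, le_div_iff₀ hα]
  linarith

end StochasticAscent

/-! ### The adapted reward as a function of the task -/

section Tasks

variable {S A Γ : Type*} [Fintype S] [MeasurableSpace Γ] {γ rmax Amax lam : ℝ}
  {M : Γ → TaskMDP S A rmax}

/-- The initial law, transition kernel and reward of a task, as a point of a finite-dimensional
space.  Joint measurability in the task is obtained from continuity on this space. -/
abbrev TaskData (S A : Type*) [Fintype S] : Type _ :=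
  ({d | ∀ s a, d.2.1 s a ∈ stdSimplex ℝ S} : Set ((S → ℝ) × (S → A → S → ℝ) × (S → A → S → ℝ)))

instance TaskData.borelSpace {S A : Type*} [Fintype S] [Fintype A] :
    BorelSpace (TaskData S A) := by
  have : BorelSpace ((S → A → S → ℝ) × (S → A → S → ℝ)) := Prod.borelSpace
  have : BorelSpace ((S → ℝ) × (S → A → S → ℝ) × (S → A → S → ℝ)) := Prod.borelSpace
  exact Subtype.borelSpace _

/-- The data of a task as a point of `TaskData`. -/
def TaskMDP.data (M : TaskMDP S A rmax) : TaskData S A :=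
  ⟨(M.init, M.trans, M.reward), M.trans_mem⟩

theorem measurable_data (hM_init : ∀ s, Measurable fun τ => (M τ).init s)
    (hM_trans : ∀ s a s', Measurable fun τ => (M τ).trans s a s')
    (hM_reward : ∀ s a s', Measurable fun τ => (M τ).reward s a s') :
    Measurable fun τ => (M τ).data := by
  refine Measurable.subtype_mk ?_
  refine (measurable_pi_lambda _ hM_init).prodMk ((measurable_pi_lambda _ fun s =>
    measurable_pi_lambda _ fun a => measurable_pi_lambda _ fun s' => hM_trans s a s').prodMk
    (measurable_pi_lambda _ fun s =>
    measurable_pi_lambda _ fun a => measurable_pi_lambda _ fun s' => hM_reward s a s'))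

theorem TaskMDP.abs_reward_le (N : TaskMDP S A rmax) (s : S) (a : A) (s' : S) :
    |N.reward s a s'| ≤ rmax := by
  rw [abs_of_nonneg (N.reward_mem s a s').1]
  exact (N.reward_mem s a s').2

variable [DecidableEq S] [Fintype A]

theorem continuous_rawReward [Nonempty A] (i : AlgIndex) (hγ₀ : 0 ≤ γ) (hγ₁ : γ < 1) :
    Continuous (Function.uncurry fun (d : TaskData S A) (φ : Param S A) =>
      rawReward i γ lam d.1.1 d.1.2.1 d.1.2.2 φ) := by
  rw [continuous_iff_continuousAt]
  rintro ⟨d, φ⟩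
  have h := (contDiffAt_rawReward (n := 1) (lam := lam)
    (ρ := fun y : ((S → ℝ) × (S → A → S → ℝ) × (S → A → S → ℝ)) × Param S A => y.1.1)
    (T := fun y => y.1.2.1) (R := fun y => y.1.2.2) (φ := fun y => y.2) (x := (d.1, φ))
    one_ne_zero i hγ₀ hγ₁ d.2 (fun s => by fun_prop) (fun s a s' => by fun_prop)
    (fun s a s' => by fun_prop) (by fun_prop)).continuousAt
  exact ContinuousAt.comp (f := fun x : TaskData S A × Param S A => (x.1.1, x.2)) (x := (d, φ)) h
    ((continuous_subtype_val.comp continuous_fst).prodMk continuous_snd).continuousAt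

variable [DecidableEq A]

/-- The state of the iteration at time `t` is a measurable function of the tasks sampled before
time `t`. -/
theorem exists_metaIterate_eq {i : AlgIndex} {α : ℝ} {φ₀ : Param S A}
    (hg : Measurable fun x : Γ × Param S A => gradient (adaptedReward i γ lam (M x.1)) x.2)
    (t : ℕ) : ∃ Ψ : (Finset.range t → Γ) → Param S A, Measurable Ψ ∧
      ∀ τ : ℕ → Γ, metaIterate i γ lam α M φ₀ τ t = Ψ fun k => τ k := by
  induction t with
  | zero => exact ⟨fun _ => φ₀, measurable_const, fun _ => rfl⟩
  | succ t ih =>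
    obtain ⟨Ψ, hΨ, hΨ_eq⟩ := ih
    set res : (Finset.range (t + 1) → Γ) → (Finset.range t → Γ) := fun y k =>
      y ⟨k, Finset.mem_range.2 ((Finset.mem_range.1 k.2).trans (Nat.lt_succ_self t))⟩ with hres
    have hresm : Measurable (fun y => Ψ (res y)) :=
      hΨ.comp (measurable_pi_lambda _ fun k => measurable_pi_apply _)
    refine ⟨fun y => Ψ (res y) + α • gradient (adaptedReward i γ lam
      (M (y ⟨t, Finset.self_mem_range_succ t⟩))) (Ψ (res y)), ?_, fun τ => ?_⟩
    · exact hresm.add ((hg.comp ((measurable_pi_apply _).prodMk hresm)).const_smul α)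
    · simp only [metaIterate, hΨ_eq, hres]

variable [Nonempty A]

theorem measurable_adaptedReward (hγ₀ : 0 ≤ γ) (hγ₁ : γ < 1) (hlam : 0 < lam) (i : AlgIndex)
    (hM : Measurable fun τ => (M τ).data) :
    Measurable fun x : Γ × Param S A => adaptedReward i γ lam (M x.1) x.2 := by
  simp only [adaptedReward_eq_rawReward hγ₀ hγ₁ hlam]
  have : OpensMeasurableSpace (TaskData S A × Param S A) := Prod.opensMeasurableSpace
  exact (continuous_rawReward i hγ₀ hγ₁).measurable.comp
    ((hM.comp measurable_fst).prodMk measurable_snd)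

theorem measurable_fderiv_adaptedReward (hγ₀ : 0 ≤ γ) (hγ₁ : γ < 1) (hlam : 0 < lam)
    (i : AlgIndex) (hM : Measurable fun τ => (M τ).data) :
    Measurable fun x : Γ × Param S A => fderiv ℝ (adaptedReward i γ lam (M x.1)) x.2 := by
  simp only [adaptedReward_eq_rawReward hγ₀ hγ₁ hlam]
  have h := measurable_fderiv_with_param ℝ
    (continuous_rawReward (S := S) (A := A) (lam := lam) i hγ₀ hγ₁)
  exact h.comp ((hM.comp measurable_fst).prodMk measurable_snd)

theorem contDiff_adaptedReward (hγ₀ : 0 ≤ γ) (hγ₁ : γ < 1) (hlam : 0 < lam)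
    (i : AlgIndex) (N : TaskMDP S A rmax) : ContDiff ℝ 2 (adaptedReward i γ lam N) := by
  rw [adaptedReward_eq_rawReward hγ₀ hγ₁ hlam]
  exact contDiff_iff_contDiffAt.2 fun φ => contDiffAt_rawReward (ρ := fun _ => N.init)
    (T := fun _ => N.trans) (R := fun _ => N.reward) two_ne_zero i hγ₀ hγ₁ N.trans_mem
    (fun _ => contDiffAt_const) (fun _ _ _ => contDiffAt_const) (fun _ _ _ => contDiffAt_const)
    contDiffAt_id

theorem abs_adaptedReward_le (hγ₀ : 0 ≤ γ) (hγ₁ : γ < 1) (hlam : 0 < lam)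
    (i : AlgIndex) (N : TaskMDP S A rmax) (φ : Param S A) :
    |adaptedReward i γ lam N φ| ≤ rmax / (1 - γ) := by
  rw [adaptedReward_eq_rawReward hγ₀ hγ₁ hlam]
  exact abs_sum_le_of_mem_stdSimplex N.init_mem (abs_bellmanValue_le hγ₀ hγ₁ N.trans_mem
    N.abs_reward_le (tiltPolicy_mem_stdSimplex i γ lam _ _ φ))

theorem abs_deriv_adaptedReward_line_le (hγ₀ : 0 ≤ γ) (hγ₁ : γ < 1) (hrmax : 0 ≤ rmax)
    (hA : 0 < Amax) (hlam : 2 * Amax ≤ lam) (i : AlgIndex) (N : TaskMDP S A rmax)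
    (hadv : ∀ (θ : Param S A) (s : S) (a : A), |advantage γ N (softmaxPolicy θ) s a| ≤ Amax)
    (φ u : Param S A) (hu : ‖u‖ = 1) (t : ℝ) :
    |deriv (fun t : ℝ => adaptedReward i γ lam N (φ + t • u)) t| ≤ i.constG γ Amax ∧
      |deriv (deriv fun t : ℝ => adaptedReward i γ lam N (φ + t • u)) t| ≤
        i.smoothness γ rmax lam := by
  rw [adaptedReward_eq_rawReward hγ₀ hγ₁ (by linarith)]
  refine abs_deriv_rawReward_line_le i hγ₀ hγ₁ hrmax hA hlam N.init_mem N.trans_mem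
    N.abs_reward_le (fun θ s a => ?_) (fun c => ?_) t
  · rw [← qFn_eq_bellmanQ hγ₀ hγ₁ N (softmaxPolicy_mem_stdSimplex θ),
      ← valueFn_eq_bellmanValue hγ₀ hγ₁ N (softmaxPolicy_mem_stdSimplex θ)]
    exact hadv θ s a
  · rw [← hu, ← Real.norm_eq_abs]
    exact PiLp.norm_apply_le u c

theorem norm_fderiv_adaptedReward_le (hγ₀ : 0 ≤ γ) (hγ₁ : γ < 1) (hrmax : 0 ≤ rmax)
    (hA : 0 < Amax) (hlam : 2 * Amax ≤ lam) (i : AlgIndex) (N : TaskMDP S A rmax)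
    (hadv : ∀ (θ : Param S A) (s : S) (a : A), |advantage γ N (softmaxPolicy θ) s a| ≤ Amax)
    (φ : Param S A) : ‖fderiv ℝ (adaptedReward i γ lam N) φ‖ ≤ i.constG γ Amax := by
  refine norm_fderiv_le_of_abs_deriv_le ?_
    ((contDiff_adaptedReward hγ₀ hγ₁ (by linarith) i N).differentiable two_ne_zero) (fun φ u hu => (abs_deriv_adaptedReward_line_le hγ₀ hγ₁ hrmax hA hlam i N hadv
      φ u hu 0).1) φ
  rw [← i.policySlope_mul_div]
  exact div_nonneg (mul_nonneg (i.policySlope_pos hγ₁).le hA.le) (by linarith)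

theorem adaptedReward_add_le (hγ₀ : 0 ≤ γ) (hγ₁ : γ < 1) (hrmax : 0 ≤ rmax)
    (hA : 0 < Amax) (hlam : 2 * Amax ≤ lam) (i : AlgIndex) (N : TaskMDP S A rmax)
    (hadv : ∀ (θ : Param S A) (s : S) (a : A), |advantage γ N (softmaxPolicy θ) s a| ≤ Amax)
    (φ v : Param S A) :
    adaptedReward i γ lam N φ + fderiv ℝ (adaptedReward i γ lam N) φ v -
      i.smoothness γ rmax lam / 2 * ‖v‖ ^ 2 ≤ adaptedReward i γ lam N (φ + v) :=
  add_fderiv_sub_le_of_abs_deriv_deriv_le (contDiff_adaptedReward hγ₀ hγ₁ (by linarith) i N)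
    (fun φ u hu t =>
    (abs_deriv_adaptedReward_line_le hγ₀ hγ₁ hrmax hA hlam i N hadv φ u hu t).2) φ v

section Meta

variable {P : Measure Γ} [IsProbabilityMeasure P]

/-- Differentiation under the expectation over tasks, dominated by the uniform gradient bound. -/
theorem hasFDerivAt_metaObjective (hγ₀ : 0 ≤ γ) (hγ₁ : γ < 1) (hrmax : 0 ≤ rmax)
    (hA : 0 < Amax) (hlam : 2 * Amax ≤ lam) (i : AlgIndex)
    (hM : Measurable fun τ => (M τ).data)
    (hadv : ∀ (τ : Γ) (θ : Param S A) (s : S) (a : A),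
      |advantage γ (M τ) (softmaxPolicy θ) s a| ≤ Amax) (φ : Param S A) :
    HasFDerivAt (metaObjective i γ lam M P)
      (∫ τ, fderiv ℝ (adaptedReward i γ lam (M τ)) φ ∂P) φ := by
  have hlam0 : 0 < lam := by linarith
  have hm : ∀ φ : Param S A, AEStronglyMeasurable (fun τ => adaptedReward i γ lam (M τ) φ) P :=
    fun φ => ((measurable_adaptedReward hγ₀ hγ₁ hlam0 i hM).comp
      (measurable_id.prodMk measurable_const)).aestronglyMeasurable
  refine hasFDerivAt_integral_of_dominated_of_fderiv_le
    (F' := fun φ τ => fderiv ℝ (adaptedReward i γ lam (M τ)) φ)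
    (bound := fun _ => i.constG γ Amax) (s := Set.univ) Filter.univ_mem
    (Filter.Eventually.of_forall hm) ?_ ?_ ?_ (integrable_const _) ?_
  · exact Integrable.of_bound (hm φ) (rmax / (1 - γ)) (Filter.Eventually.of_forall fun τ =>
      abs_adaptedReward_le hγ₀ hγ₁ hlam0 i (M τ) φ)
  · exact ((measurable_fderiv_adaptedReward hγ₀ hγ₁ hlam0 i hM).comp
      (measurable_id.prodMk measurable_const)).aestronglyMeasurable
  · exact Filter.Eventually.of_forall fun τ φ _ =>
      norm_fderiv_adaptedReward_le hγ₀ hγ₁ hrmax hA hlam i (M τ) (hadv τ) φ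
  · exact Filter.Eventually.of_forall fun τ φ _ =>
      ((contDiff_adaptedReward hγ₀ hγ₁ hlam0 i (M τ)).differentiable two_ne_zero φ).hasFDerivAt

end Meta

end Tasks

/-! ### The constants of the rate -/

section Rate

variable {γ r lam Amax : ℝ}

theorem AlgIndex.constB_pos (i : AlgIndex) (hγ₁ : γ < 1) (hr : 0 < r) (hlam : 0 < lam) :
    0 < i.constB γ r lam := by
  have hd : 0 < 1 - γ := by linarith
  cases i <;> simp only [AlgIndex.constB] <;> positivity

theorem AlgIndex.constG_pos (i : AlgIndex) (hγ₁ : γ < 1) (hA : 0 < Amax) :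
    0 < i.constG γ Amax := by
  have hd : 0 < 1 - γ := by linarith
  cases i <;> simp only [AlgIndex.constG] <;> positivity

theorem AlgIndex.smoothness_nonneg (i : AlgIndex) (hγ₀ : 0 ≤ γ) (hγ₁ : γ < 1) (hr : 0 ≤ r)
    (hlam : 0 < lam) : 0 ≤ i.smoothness γ r lam := by
  have hd : 0 < 1 - γ := by linarith
  cases i <;> simp only [AlgIndex.smoothness, AlgIndex.policyCurvature, AlgIndex.policySlope] <;>
    positivity

/-- The comparison of constants behind the `1 / √T` term of the rate. -/
theorem AlgIndex.two_mul_add_smoothness_le (i : AlgIndex) (hγ₀ : 0 ≤ γ) (hγ₁ : γ < 1)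
    (hr : 0 < r) (hlam : 0 < lam) :
    2 * (r / (1 - γ)) + i.smoothness γ r lam / 2 ≤
      (i.constB γ r lam + 2 * i.constC γ ^ 2) * r / (1 - γ) ^ 4 := by
  have hd : 0 < 1 - γ := by linarith
  -- Both sides are polynomials in `e = 1 / (1 - γ) ≥ 1`.
  obtain ⟨e, he⟩ : ∃ e, e = (1 - γ)⁻¹ := ⟨_, rfl⟩
  obtain ⟨l, hl⟩ : ∃ l, l = lam⁻¹ := ⟨_, rfl⟩
  have he1 : 1 ≤ e := by
    rw [he]
    exact (one_le_inv₀ hd).2 (by linarith)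
  have hl0 : 0 < l := by
    rw [hl]
    positivity
  have e46 : e ^ 4 ≤ e ^ 6 := pow_le_pow_right₀ he1 (by norm_num)
  have e14 : e ≤ e ^ 6 := le_self_pow₀ he1 (by norm_num)
  have e57 : (r * l) * e ^ 5 ≤ (r * l) * e ^ 7 :=
    mul_le_mul_of_nonneg_left (pow_le_pow_right₀ he1 (by norm_num)) (by positivity)
  have e5 : γ * e ^ 5 ≤ e ^ 5 := mul_le_of_le_one_left (by positivity) hγ₁.le
  have e56 : e ^ 5 ≤ e ^ 6 := pow_le_pow_right₀ he1 (by norm_num)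
  have hle : 0 ≤ l * e ^ 4 := by positivity
  have h7 : 0 ≤ r * l * e ^ 7 := by positivity
  cases i with
  | one =>
    have h := mul_le_mul_of_nonneg_left (show 2 * e + (54 * e ^ 4 + 16 * (r * l * e ^ 5) +
      16 * (γ * e ^ 5)) ≤ 16 * (r * l * e ^ 7) + 24 * e ^ 5 + 12 * (l * e ^ 4) + 72 * e ^ 6 by
        linarith [pow_nonneg (zero_le_one.trans he1) 5]) hr.le
    simp only [AlgIndex.smoothness, AlgIndex.policyCurvature, AlgIndex.policySlope,
      AlgIndex.constB, AlgIndex.constC, div_eq_mul_inv, mul_inv, ← inv_pow, ← he, ← hl]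
    linarith
  | two =>
    have h := mul_le_mul_of_nonneg_left (show 2 * e + (4 * e ^ 4 + 8 * (r * l * e ^ 5) +
      4 * (γ * e ^ 5)) ≤ 16 * (r * l * e ^ 7) + 50 * e ^ 6 by linarith) hr.le
    simp only [AlgIndex.smoothness, AlgIndex.policyCurvature, AlgIndex.policySlope,
      AlgIndex.constB, AlgIndex.constC, div_eq_mul_inv, mul_inv, ← inv_pow, ← he, ← hl]
    linarith

/-- The choice of step size turns the bound for stochastic gradient ascent into the stated rate. -/
theorem AlgIndex.rate_le (i : AlgIndex) (hγ₀ : 0 ≤ γ) (hγ₁ : γ < 1) (hr : 0 < r)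
    (hlam : 0 < lam) (hA : 0 < Amax) {T : ℕ} (hT : 1 ≤ T) :
    0 < i.stepSize γ r Amax lam T ∧
    1 / (T : ℝ) * (2 * (r / (1 - γ)) / i.stepSize γ r Amax lam T +
      T * (i.smoothness γ r lam * i.stepSize γ r Amax lam T * i.constG γ Amax ^ 2 / 2)) ≤
      i.constK γ r lam / T + i.constM γ r Amax lam / √(T : ℝ) := by
  have hd : 0 < 1 - γ := by linarith
  have hd1 : 1 - γ ≤ 1 := by linarith
  have hTpos : 0 < (T : ℝ) := by exact_mod_cast hT
  have hs : 0 < √(T : ℝ) := Real.sqrt_pos.2 hTpos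
  have hss : √(T : ℝ) * √(T : ℝ) = T := Real.mul_self_sqrt hTpos.le
  have hB := i.constB_pos hγ₁ hr hlam
  have hG := i.constG_pos hγ₁ hA
  have hL := i.smoothness_nonneg hγ₀ hγ₁ hr.le hlam
  have hM := i.two_mul_add_smoothness_le hγ₀ hγ₁ hr hlam
  set B := i.constB γ r lam
  set C := i.constC γ
  set G := i.constG γ Amax
  set L := i.smoothness γ r lam
  set s := √(T : ℝ)
  set L₀ := r * B / (1 - γ) ^ 2 + 2 * γ * r * C ^ 2 / (1 - γ) ^ 3 with hL₀
  have hL₀pos : 0 < L₀ := by positivity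
  have hα : i.stepSize γ r Amax lam T = min L₀⁻¹ (1 / (G * s)) := rfl
  set α := i.stepSize γ r Amax lam T
  have hαpos : 0 < α := by
    rw [hα]
    exact lt_min (by positivity) (by positivity)
  refine ⟨hαpos, ?_⟩
  have hinv : 1 / α ≤ L₀ + G * s := by
    rw [hα]
    rcases min_choice L₀⁻¹ (1 / (G * s)) with h | h <;> rw [h]
    · rw [one_div, inv_inv]
      have : 0 < G * s := by positivity
      linarith
    · rw [one_div_one_div]
      linarith
  have hαle : α * G ≤ 1 / s := by
    have : α ≤ 1 / (G * s) := hα ▸ min_le_right _ _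
    calc α * G ≤ 1 / (G * s) * G := by gcongr
      _ = 1 / s := by field_simp
  have hK : 2 * (r / (1 - γ)) * L₀ ≤ i.constK γ r lam := by
    have h1 : 2 * (r / (1 - γ)) * L₀ =
        2 * r ^ 2 * (B * (1 - γ) + 2 * γ * C ^ 2) / (1 - γ) ^ 4 := by
      rw [hL₀]
      field_simp
    have h2 : i.constK γ r lam = 2 * r ^ 2 * (B + 2 * C ^ 2) / (1 - γ) ^ 4 := by
      change 2 * (B + 2 * C ^ 2) * r ^ 2 / (1 - γ) ^ 4 = _
      ring
    rw [h1, h2]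
    have h3 : B * (1 - γ) ≤ B := mul_le_of_le_one_right hB.le hd1
    have h4 : γ * C ^ 2 ≤ C ^ 2 := mul_le_of_le_one_left (sq_nonneg _) hγ₁.le
    gcongr
    linarith
  have hMG : (2 * (r / (1 - γ)) + L / 2) * G ≤ i.constM γ r Amax lam := by
    have h2 : i.constM γ r Amax lam = (B + 2 * C ^ 2) * r / (1 - γ) ^ 4 * G := by
      change (B + 2 * C ^ 2) * G * r / (1 - γ) ^ 4 = _
      ring
    rw [h2]
    exact mul_le_mul_of_nonneg_right hM hG.le
  have hR : 0 ≤ 2 * (r / (1 - γ)) := by positivity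
  calc 1 / (T : ℝ) * (2 * (r / (1 - γ)) / α + T * (L * α * G ^ 2 / 2))
      = 2 * (r / (1 - γ)) * (1 / α) / T + L / 2 * G * (α * G) := by
        field_simp
    _ ≤ 2 * (r / (1 - γ)) * (L₀ + G * s) / T + L / 2 * G * (1 / s) := by gcongr
    _ = 2 * (r / (1 - γ)) * L₀ / T + (2 * (r / (1 - γ)) + L / 2) * G / s := by
        rw [← hss]
        field_simp
        ring
    _ ≤ _ := by gcongr

end Rate

/-! ### The convergence rate -/

theorem theorem1 {S A Γ Ω : Type*} [Fintype S] [DecidableEq S]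
    [Fintype A] [DecidableEq A] [Nonempty A]
    [MeasurableSpace Γ] [MeasurableSpace Ω]
    (γ rmax Amax lam : ℝ) (hγ₀ : 0 ≤ γ) (hγ₁ : γ < 1) (hrmax : 0 < rmax) (hAmax : 0 < Amax)
    -- the tasks, and the task distribution `P`
    (M : Γ → TaskMDP S A rmax)
    (hM_init : ∀ s, Measurable fun τ => (M τ).init s)
    (hM_trans : ∀ s a s', Measurable fun τ => (M τ).trans s a s')
    (hM_reward : ∀ s a s', Measurable fun τ => (M τ).reward s a s')
    (P : Measure Γ) [IsProbabilityMeasure P]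
    -- upper bound of the advantage function
    (hadv : ∀ (τ : Γ) (θ : Param S A) (s : S) (a : A),
      |advantage γ (M τ) (softmaxPolicy θ) s a| ≤ Amax)
    -- sufficient state visit
    (hvisit : ∀ (τ : Γ) (R : ℝ), ∃ ε : ℝ, 0 < ε ∧ ∀ φ : Param S A, ‖φ‖ ≤ R →
      ∀ s, ε ≤ visitation γ (M τ) (softmaxPolicy φ) s)
    (hlam : 2 * Amax ≤ lam)
    (i : AlgIndex) (T : ℕ) (hT : 1 ≤ T) (φ₀ : Param S A)
    -- the i.i.d. sampled tasks
    (μ : Measure Ω) [IsProbabilityMeasure μ] (τ : ℕ → Ω → Γ)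
    (hτ_meas : ∀ t, Measurable (τ t)) (hτ_law : ∀ t, μ.map (τ t) = P)
    (hτ_indep : iIndepFun τ μ) :
    -- the adapted policy is the unique maximizer, and the hypergradients exist
    (∀ (g : Γ) (φ : Param S A) (s : S) (q : A → ℝ),
      IsAdapted i γ lam (M g) φ s q ↔ q = alg i γ lam (M g) φ s) ∧
    (∀ g : Γ, Differentiable ℝ (adaptedReward i γ lam (M g))) ∧
    (∀ φ : Param S A, Integrable (fun g => adaptedReward i γ lam (M g) φ) P) ∧
    Differentiable ℝ (metaObjective i γ lam M P) ∧
    -- the expectations in the bound exist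
    (∀ t : ℕ, Integrable (fun ω => ‖gradient (metaObjective i γ lam M P)
      (metaIterate i γ lam (i.stepSize γ rmax Amax lam T) M φ₀ (fun k => τ k ω) t)‖ ^ 2) μ) ∧
    -- the convergence rate
    1 / (T : ℝ) * ∑ t ∈ Finset.Icc 1 T,
        ∫ ω, ‖gradient (metaObjective i γ lam M P)
          (metaIterate i γ lam (i.stepSize γ rmax Amax lam T) M φ₀
            (fun k => τ k ω) t)‖ ^ 2 ∂μ
      ≤ i.constK γ rmax lam / T + i.constM γ rmax Amax lam / √(T : ℝ) := by
  have hlam0 : 0 < lam := by linarith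
  have hM : Measurable fun τ => (M τ).data := measurable_data hM_init hM_trans hM_reward
  have hdiff : ∀ g : Γ, Differentiable ℝ (adaptedReward i γ lam (M g)) := fun g =>
    (contDiff_adaptedReward hγ₀ hγ₁ hlam0 i (M g)).differentiable two_ne_zero
  have hint : ∀ φ : Param S A, Integrable (fun g => adaptedReward i γ lam (M g) φ) P := fun φ =>
    Integrable.of_bound ((measurable_adaptedReward hγ₀ hγ₁ hlam0 i hM).comp
      (measurable_id.prodMk measurable_const)).aestronglyMeasurable (rmax / (1 - γ))
      (Filter.Eventually.of_forall fun g => abs_adaptedReward_le hγ₀ hγ₁ hlam0 i (M g) φ)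
  have hF := hasFDerivAt_metaObjective (P := P) hγ₀ hγ₁ hrmax.le hAmax hlam i hM hadv
  have hFdiff : Differentiable ℝ (metaObjective i γ lam M P) := fun φ =>
    (hF φ).differentiableAt
  have hfm : ∀ φ, Measurable fun g => fderiv ℝ (adaptedReward i γ lam (M g)) φ := fun φ =>
    (measurable_fderiv_adaptedReward hγ₀ hγ₁ hlam0 i hM).comp
      (measurable_id.prodMk measurable_const)
  have hfb : ∀ g φ, ‖fderiv ℝ (adaptedReward i γ lam (M g)) φ‖ ≤ i.constG γ Amax := fun g φ =>
    norm_fderiv_adaptedReward_le hγ₀ hγ₁ hrmax.le hAmax hlam i (M g) (hadv g) φ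
  have hfint : ∀ φ, Integrable (fun g => fderiv ℝ (adaptedReward i γ lam (M g)) φ) P := fun φ =>
    Integrable.of_bound (hfm φ).aestronglyMeasurable _
      (Filter.Eventually.of_forall fun g => hfb g φ)
  have hgm : Measurable fun x : Γ × Param S A =>
      gradient (adaptedReward i γ lam (M x.1)) x.2 :=
    (InnerProductSpace.toDual ℝ (Param S A)).symm.continuous.measurable.comp
      (measurable_fderiv_adaptedReward hγ₀ hγ₁ hlam0 i hM)
  have hgb : ∀ g φ, ‖gradient (adaptedReward i γ lam (M g)) φ‖ ≤ i.constG γ Amax := fun g φ => by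
    rw [gradient, LinearIsometryEquiv.norm_map]
    exact hfb g φ
  have hgF : ∀ φ, ∫ g, gradient (adaptedReward i γ lam (M g)) φ ∂P =
      gradient (metaObjective i γ lam M P) φ := fun φ => by
    simp only [gradient]
    rw [(hF φ).fderiv]
    exact ContinuousLinearMap.integral_comp_comm
      (InnerProductSpace.toDual ℝ (Param S A)).symm.toContinuousLinearEquiv.toContinuousLinearMap
      (hfint φ)
  have hFR : ∀ φ, |metaObjective i γ lam M P φ| ≤ rmax / (1 - γ) := fun φ => by
    have := norm_integral_le_of_norm_le_const (μ := P)
      (f := fun g => adaptedReward i γ lam (M g) φ) (C := rmax / (1 - γ))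
      (Filter.Eventually.of_forall fun g => abs_adaptedReward_le hγ₀ hγ₁ hlam0 i (M g) φ)
    simpa [metaObjective] using this
  have hFL : ∀ φ v, metaObjective i γ lam M P φ +
      inner ℝ (gradient (metaObjective i γ lam M P) φ) v -
        i.smoothness γ rmax lam / 2 * ‖v‖ ^ 2 ≤ metaObjective i γ lam M P (φ + v) := by
    intro φ v
    have h1 : inner ℝ (gradient (metaObjective i γ lam M P) φ) v =
        ∫ g, fderiv ℝ (adaptedReward i γ lam (M g)) φ v ∂P := by
      rw [gradient, InnerProductSpace.toDual_symm_apply, (hF φ).fderiv,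
        ContinuousLinearMap.integral_apply (hfint φ)]
    have h2 : i.smoothness γ rmax lam / 2 * ‖v‖ ^ 2 =
        ∫ _g, i.smoothness γ rmax lam / 2 * ‖v‖ ^ 2 ∂P := by simp
    have hv : Integrable (fun g => fderiv ℝ (adaptedReward i γ lam (M g)) φ v) P :=
      (hfint φ).apply_continuousLinearMap v
    have hadd : Integrable (fun g => adaptedReward i γ lam (M g) φ +
        fderiv ℝ (adaptedReward i γ lam (M g)) φ v) P := (hint φ).add hv
    rw [h1, h2, metaObjective, ← integral_add (hint φ) hv, ← integral_sub hadd (integrable_const _)]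
    exact integral_mono (hadd.sub (integrable_const _)) (hint (φ + v)) fun g =>
      adaptedReward_add_le hγ₀ hγ₁ hrmax.le hAmax hlam i (M g) (hadv g) φ v
  obtain ⟨hα, hrate⟩ := i.rate_le hγ₀ hγ₁ hrmax hlam0 hAmax hT
  set α := i.stepSize γ rmax Amax lam T
  set X : ℕ → Ω → Param S A := fun t ω => metaIterate i γ lam α M φ₀ (fun k => τ k ω) t with hX
  have hXind : ∀ t, Measurable (X t) ∧ IndepFun (X t) (τ t) μ := by
    intro t
    obtain ⟨Ψ, hΨ, hΨ_eq⟩ := exists_metaIterate_eq (i := i) (α := α) (φ₀ := φ₀) hgm t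
    have hXt : X t = Ψ ∘ fun ω (k : Finset.range t) => τ k ω := funext fun ω => hΨ_eq _
    refine ⟨hXt ▸ hΨ.comp (measurable_pi_lambda _ fun k => hτ_meas k), ?_⟩
    have h := hτ_indep.indepFun_finset (Finset.range t) {t}
      (Finset.disjoint_singleton_right.2 Finset.notMem_range_self) hτ_meas
    rw [hXt]
    exact h.comp hΨ (measurable_pi_apply (⟨t, Finset.mem_singleton_self t⟩ : ({t} : Finset ℕ)))
  obtain ⟨hsq, hsum⟩ := sum_integral_norm_gradient_sq_le (P := P) (μ := μ) (X := X) (τ := τ)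
    (g := fun g φ => gradient (adaptedReward i γ lam (M g)) φ) hα
    (i.smoothness_nonneg hγ₀ hγ₁ hrmax.le hlam0) hgm hgb hgF hFdiff.continuous.measurable hFR hFL
    (fun t => (hXind t).1) hτ_meas hτ_law (fun t => (hXind t).2) (fun t ω => rfl) T
  refine ⟨fun g φ s q => ?_, hdiff, hint, hFdiff, hsq, ?_⟩
  · rw [alg_eq_tiltPolicy hγ₀ hγ₁ hlam0]
    exact isAdapted_iff_eq_tiltPolicy hγ₀ hγ₁ hlam0 i (M g) φ s q
  · exact (mul_le_mul_of_nonneg_left hsum (by positivity)).trans hrate
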